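/- **Setup.** Let $\Sigma$ be a finite token alphabet, $\mathcal X\subseteq\Sigma^*$ a set of (finite or infinite) strings, $\rho$ a probability measure on $\mathcal X$, and $\mathcal V:\mathcal X\times\Sigma\to\{0,1\}$ an outcome verifier. A model is a (possibly stochastic) next-token predictor $\pi:\Sigma^*\to\Delta_\Sigma$. For $T\ge 1$, $\pi_{1:T}(\cdot\mid x)$ is the law of $(y_1,\dots,y_T)$ generated by $y_t\sim\pi(\cdot\mid x,y_1,\dots,y_{t-1})$, and $\pi_T(\cdot\mid x)$ is the law of $y_T$. For $f:\mathcal X\to\Delta_\Sigma$ put $\mathrm{Acc}_x(f)=\Pr_{y\sim f(\cdot\mid x)}(\mathcal V(x,y)=1)$ and, for a model, $\mathrm{Acc}_x(\pi)=\mathrm{Acc}_x(\pi_T)$. Let $\Pi$ be a finite class of models with $|\Pi|\ge 2$ containing some $\pi^\star$ with $\mathbb E_{x\sim\rho}[\mathrm{Acc}_x(\pi^\star)]=1$. A query $\mathrm{CoT}(x)$ returns a fresh draw from $\pi^\star_{1:T}(\cdot\mid x)$. A log-loss ERM oracle maps a data set $(x_i,y_i)_{i=1}^N$ to a minimizer over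 $\pi\in\Pi$ of $\frac1{NT}\sum_{i=1}^N\sum_{t=1}^T\log\frac1{\pi(y_{i,t}\mid x_i,y_{i,1:t-1})}$ (any measurable tie-breaking). **Algorithm** ($\mathrm{AutoTune}_{\mathrm{stoch}}$, with absolute constants $C,c>0$ and $m\in\mathbb N$). Let $k=\lceil C\log(1/\varepsilon)/(1/400)^2\rceil$ and $$N=\big\lceil c\,\log(|\Pi|k/\delta)\,\log(400)\,400^2\big\rceil ,$$ the number of samples given to log-loss next-token prediction for accuracy $1-\frac1{400}$ and confidence $1-\frac{\delta}{k}$. Define $\beta^{k,k}_r=\mathbb I(r\le 4k/5)$, $\beta^{j,k}_r=\frac1{10}\beta^{j+1,k}_r+\frac9{10}\beta^{j+1,k}_{r+1}$ for $j<k$, and $\alpha^{j,k}_r=\beta^{j+1,k}_r-\beta^{j+1,k}_{r+1}$. Split the $n$ i.i.d. prompts $x_i\sim\rho$ into $k$ parts of size $\lfloor n/k\rfloor$. In phase $j=0,\dots,k-1$, go through the prompts $x$ of part $j$ in order, stopping as soon as $N$ prompts have been kept. For each $x$ compute $\widehat{\mathrm{rank}}_j(x)$, the number of $r<j$ such that at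 least a fraction $\frac9{10}$ of $m$ fresh independent answers drawn from $\hat\pi^r_T(\cdot\mid x)$ are accepted by $\mathcal V$; draw $\eta\sim\mathrm{Unif}[0,1]$ and keep $x$ if $\eta\le\alpha^{j,k}_{\widehat{\mathrm{rank}}_j(x)}/\max_{0\le r\le j}\alpha^{j,k}_r$. Query $\mathrm{CoT}$ once on each kept prompt and let $\hat\pi^j$ be the output of the ERM oracle on the resulting data. Return $\hat f=\frac1k\sum_{j=0}^{k-1}\hat\pi^j_T$. **Theorem (Autocurriculum for SFT with general models).** If the absolute constants $C,c,m$ of the algorithm are sufficiently large, then there are constants $A,B,K>0$ and $a,b\in\mathbb N$, depending only on $C,c,m$, such that for all $\Sigma,\mathcal X,\rho,\mathcal V,T,\Pi,\pi^\star$ as above, every log-loss ERM oracle for $\Pi$, all $\varepsilon\in(0,1)$, $\delta\in(0,\frac12)$, and all $$n\ \ge\ \frac{\log|\Pi|}{\varepsilon}\cdot A\Big(1+\log\tfrac1\varepsilon+\log\tfrac1\delta+\log T\Big)^{a},$$ the algorithm 1. always makes at most $\log|\Pi|\cdot B\big(1+\log\frac1\varepsilon+\log\frac1\delta+\log T\big)^{b}$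 queries to $\mathrm{CoT}$; 2. always makes at most $K\big(1+\log\frac1\varepsilon\big)$ calls to the log-loss ERM oracle; 3. returns, with probability at least $1-\delta$, an $\hat f$ with $\Pr_{x\sim\rho}\big(\mathrm{Acc}_x(\hat f)\ge\frac35\big)\ge 1-\varepsilon$. -/

import Mathlib

open MeasureTheory ProbabilityTheory
open scoped ENNReal

namespace Autocurriculum

/-! ### Strings, next-token models and the distributions they induce -/

/-- Strings over the token alphabet, of finite (`Sum.inl`) or infinite (`Sum.inr`) length. -/
def Str (Tok : Type*) : Type _ := List Tok ⊕ (ℕ → Tok)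

/-- The σ-algebra on strings: all sets of finite strings, and the product σ-algebra on
infinite ones. -/
instance Str.instMeasurableSpace (Tok : Type*) [MeasurableSpace Tok] :
    MeasurableSpace (Str Tok) :=
  @Sum.instMeasurableSpace (List Tok) (ℕ → Tok) ⊤ MeasurableSpace.pi

/-- Concatenation of a string with a finite string (an infinite string absorbs what follows). -/
def Str.append {Tok : Type*} : Str Tok → List Tok → Str Tok
  | Sum.inl l, y => Sum.inl (l ++ y)
  | Sum.inr s, _ => Sum.inr s

theorem Str.measurable_append {Tok : Type*} [MeasurableSpace Tok] (y : List Tok) :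
    Measurable (fun s : Str Tok => s.append y) := by
  let _ : MeasurableSpace (List Tok) := ⊤
  have h1 : @Measurable (List Tok) (Str Tok) ⊤ _ (fun l => Str.append (Sum.inl l) y) :=
    fun _ _ => trivial
  have h2 : Measurable (fun s : ℕ → Tok => (Str.append (Sum.inr s) y : Str Tok)) :=
    @measurable_inr (List Tok) (ℕ → Tok) ⊤ _
  exact @measurable_fun_sum (List Tok) (ℕ → Tok) (Str Tok) ⊤ _ _ _ h1 h2

variable {Tok : Type*} [MeasurableSpace Tok]

/-- A (possibly stochastic) next-token model: a measurable map from prefixes to distributions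
over tokens. -/
structure Model (Tok : Type*) [MeasurableSpace Tok] where
  next : Str Tok → PMF Tok
  measurable_next : ∀ a : Tok, Measurable fun s => next s a

/-- The chain-of-thought distribution `π_{1:T}(· | s)`: tokens are generated one after the other,
`y_{t+1} ∼ π(· | s, y_1, …, y_t)`. -/
noncomputable def cot (π : Model Tok) (s : Str Tok) : (T : ℕ) → PMF (Fin T → Tok)
  | 0 => PMF.pure Fin.elim0
  | T + 1 => (cot π s T).bind fun y =>
      (π.next (s.append (List.ofFn y))).map fun a => Fin.snoc (α := fun _ => Tok) y a

/-- The last position of a chain of thought, where the answer stands. -/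
def lastPos (T : ℕ) [NeZero T] : Fin T := ⟨T - 1, Nat.sub_one_lt (NeZero.ne T)⟩

/-- The outcome distribution `π_T(· | s)`: the law of the final token of the chain of thought. -/
noncomputable def outcome (π : Model Tok) (T : ℕ) [NeZero T] (s : Str Tok) : PMF Tok :=
  (cot π s T).map fun y => y (lastPos T)

variable [Fintype Tok] {X : Set (Str Tok)}

/-- `Acc_x(f)` for an outcome-level model `f`: the probability that an answer drawn from
`f(· | x)` is accepted by the verifier `V`. -/
noncomputable def accAt (V : X → Tok → Bool) (f : X → PMF Tok) (x : X) : ℝ≥0∞ :=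
  ∑ a : Tok, if V x a = true then f x a else 0

/-- `Acc_ρ(f)`: the average accuracy over prompts `x ∼ ρ`. -/
noncomputable def acc (ρ : Measure X) (V : X → Tok → Bool) (f : X → PMF Tok) : ℝ≥0∞ :=
  ∫⁻ x, accAt V f x ∂ρ

/-! ### Next-token prediction with the log-loss -/

/-- The empirical log-loss
`(1 / (N T)) ∑_i ∑_t log (1 / π(y_{i,t} | x_i, y_{i,1}, …, y_{i,t-1}))`, with `log (1 / 0) = ∞`. -/
noncomputable def empLogLoss {T N : ℕ} (π : Model Tok) (D : Fin N → X × (Fin T → Tok)) : EReal :=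
  (((N * T : ℝ)⁻¹ : ℝ) : EReal) * ∑ i : Fin N, ∑ t : Fin T,
    ENNReal.log ((π.next ((D i).1.1.append ((List.ofFn (D i).2).take t)) ((D i).2 t))⁻¹)

/-- A log-loss ERM oracle for the class `M`: it maps every data set of chains of thought to a
minimizer over `M` of the empirical log-loss (ties are broken in any measurable way). -/
structure ERMOracle (M : Finset (Model Tok)) (X : Set (Str Tok)) (T : ℕ) where
  fit : (N : ℕ) → (Fin N → X × (Fin T → Tok)) → M
  fit_le : ∀ (N : ℕ) (D : Fin N → X × (Fin T → Tok)), ∀ π ∈ M,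
    empLogLoss (fit N D).1 D ≤ empLogLoss π D
  measurableSet_fit : ∀ (N : ℕ) (π : M), MeasurableSet {D | fit N D = π}

/-- The number of samples that next-token prediction is given for accuracy `1 - ε` and confidence
`1 - δ` when the class has `card` elements: `c · log(card / δ) · log(1 / ε) / ε²`, rounded up. -/
noncomputable def nPrompt (c : ℝ) (card : ℕ) (ε δ : ℝ) : ℕ :=
  ⌈c * (Real.log (card / δ) * Real.log (1 / ε) / ε ^ 2)⌉₊

/-! ### The weights -/

/-- `betaW k (k - j) r` is the quantity `β_r^{j,k}`, by recursion on the number `k - j` of remaining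
phases. -/
noncomputable def betaW (k : ℕ) : ℕ → ℕ → ℝ
  | 0, r => if (r : ℝ) ≤ 4 * k / 5 then 1 else 0
  | i + 1, r => (1 / 10) * betaW k i r + (1 - 1 / 10) * betaW k i (r + 1)

/-- `α_r^{j,k} = β_r^{j+1,k} - β_{r+1}^{j+1,k}`. -/
noncomputable def alphaW (k j r : ℕ) : ℝ :=
  betaW k (k - (j + 1)) r - betaW k (k - (j + 1)) (r + 1)

/-- `max_{0 ≤ r ≤ j} α_r^{j,k}`. -/
noncomputable def alphaMax (k j : ℕ) : ℝ :=
  (Finset.range (j + 1)).sup' Finset.nonempty_range_add_one (alphaW k j)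

/-! ### The randomness -/

/-- What comes with one prompt of the data set: the uniform variable used for rejection sampling,
the answer of the CoT oracle if it is queried on this prompt, and the rollouts: entry `(r, π, i)`
is the `i`-th answer sampled from `π` if the `r`-th model of the ensemble is `π`. -/
abbrev Tape (M : Finset (Model Tok)) (T k m : ℕ) : Type _ :=
  ℝ × (Fin T → Tok) × (Fin k × M × Fin m → Tok)

theorem measurable_of_measurable_singleton {α β : Type*} [MeasurableSpace α] [MeasurableSpace β]
    [Finite β] [MeasurableSingletonClass β] {f : α → Measure β}
    (h : ∀ b, Measurable fun a => f a {b}) : Measurable f := by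
  classical
  refine Measure.measurable_of_measurable_coe _ fun s _ => ?_
  have hs : s.Finite := Set.toFinite s
  have : (fun a => f a s) = fun a => ∑ b ∈ hs.toFinset, f a {b} := by
    funext a
    rw [sum_measure_singleton, hs.coe_toFinset]
  rw [this]
  exact Finset.measurable_sum _ fun b _ => h b

theorem measurable_cot [DiscreteMeasurableSpace Tok] (π : Model Tok) (T : ℕ) (y : Fin T → Tok) :
    Measurable fun s : Str Tok => cot π s T y := by
  classical
  induction T with
  | zero => simp only [cot]; exact measurable_const
  | succ T ih =>
    simp only [cot, PMF.bind_apply, PMF.map_apply, tsum_fintype]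
    refine Finset.measurable_sum _ fun z _ => (ih z).mul (Finset.measurable_sum _ fun a _ => ?_)
    split_ifs
    · exact (π.measurable_next a).comp (Str.measurable_append _)
    · exact measurable_const

/-- The CoT oracle with teacher `π`: on the prompt `x` it returns a draw from `π_{1:T}(· | x)`. -/
noncomputable def cotKernel [DiscreteMeasurableSpace Tok] (π : Model Tok) (X : Set (Str Tok))
    (T : ℕ) : Kernel X (Fin T → Tok) where
  toFun x := (cot π x.1 T).toMeasure
  measurable' := by
    refine measurable_of_measurable_singleton fun y => ?_
    simp only [PMF.toMeasure_apply_singleton _ _ (measurableSet_singleton _)]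
    exact (measurable_cot π T y).comp measurable_subtype_coe

theorem measurable_outcome [DiscreteMeasurableSpace Tok] (π : Model Tok) (T : ℕ) [NeZero T]
    (a : Tok) : Measurable fun s : Str Tok => outcome π T s a := by
  classical
  simp only [outcome, PMF.map_apply, tsum_fintype]
  refine Finset.measurable_sum _ fun z _ => ?_
  split_ifs
  · exact measurable_cot π T z
  · exact measurable_const

/-- Independent rollouts on a prompt `x`: entry `(r, π, i)` has law `π_T(· | x)`. -/
noncomputable def rolloutKernel [DiscreteMeasurableSpace Tok] (M : Finset (Model Tok))
    (X : Set (Str Tok)) (T : ℕ) [NeZero T] (k m : ℕ) :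
    Kernel X (Fin k × M × Fin m → Tok) where
  toFun x := Measure.pi fun q => (outcome q.2.1.1 T x.1).toMeasure
  measurable' := by
    refine measurable_of_measurable_singleton fun Y => ?_
    simp only [Measure.pi_singleton,
      PMF.toMeasure_apply_singleton _ _ (measurableSet_singleton _)]
    exact Finset.measurable_prod _ fun q _ =>
      (measurable_outcome q.2.1.1 T (Y q)).comp measurable_subtype_coe

instance [DiscreteMeasurableSpace Tok] (π : Model Tok) (X : Set (Str Tok)) (T : ℕ) :
    IsMarkovKernel (cotKernel π X T) :=
  ⟨fun x => inferInstanceAs (IsProbabilityMeasure (cot π x.1 T).toMeasure)⟩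

instance [DiscreteMeasurableSpace Tok] (M : Finset (Model Tok)) (X : Set (Str Tok)) (T : ℕ)
    [NeZero T] (k m : ℕ) : IsMarkovKernel (rolloutKernel M X T k m) :=
  ⟨fun x => inferInstanceAs (IsProbabilityMeasure
    (Measure.pi fun q : Fin k × M × Fin m => (outcome q.2.1.1 T x.1).toMeasure))⟩

/-- The uniform distribution on `[0, 1]`. -/
noncomputable def unif01 : Measure ℝ := volume.restrict (Set.Icc 0 1)

/-- The joint law of a prompt `x ∼ ρ` and its tape; given `x`, the three parts of the tape are
independent. -/
noncomputable def promptLaw [DiscreteMeasurableSpace Tok] (ρ : Measure X) (πstar : Model Tok)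
    (M : Finset (Model Tok)) (T : ℕ) [NeZero T] (k m : ℕ) : Measure (X × Tape M T k m) :=
  ρ ⊗ₘ (Kernel.const X unif01 ×ₖ (cotKernel πstar X T ×ₖ rolloutKernel M X T k m))

/-- The law of the whole input: `n` independent prompts with their tapes. -/
noncomputable def inputLaw [DiscreteMeasurableSpace Tok] (ρ : Measure X) (πstar : Model Tok)
    (M : Finset (Model Tok)) (T : ℕ) [NeZero T] (k m n : ℕ) :
    Measure (Fin n → X × Tape M T k m) :=
  Measure.pi fun _ => promptLaw ρ πstar M T k m

/-! ### The algorithm -/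

variable {M : Finset (Model Tok)} {T k m : ℕ}

/-- The Monte-Carlo estimate `(1 / m) ∑_i 1[V(x, Y_i) = 1]` of the accuracy on `x`. -/
noncomputable def accHat (V : X → Tok → Bool) (x : X) (Y : Fin m → Tok) : ℝ :=
  (∑ i : Fin m, if V x (Y i) = true then (1 : ℝ) else 0) / m

/-- The estimated rank: the number of models of the ensemble whose estimated accuracy on the
prompt is at least `9/10`. -/
noncomputable def rankHat (V : X → Tok → Bool) {j : ℕ} (hj : j ≤ k) (ens : Fin j → M)
    (z : X × Tape M T k m) : ℕ :=
  ∑ r : Fin j,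
    if 9 / 10 ≤ accHat V z.1 (fun i => z.2.2.2 (Fin.castLE hj r, ens r, i)) then 1 else 0

open Classical in
/-- Rejection sampling: go through the prompts in order, keep the accepted ones, and stop as soon
as `N` of them have been kept. -/
noncomputable def sample {Z : Type*} (accept : Z → Prop) (N : ℕ) (out : List Z) : List Z → List Z
  | [] => out
  | z :: zs =>
    if N ≤ out.length then out
    else if accept z then sample accept N (out ++ [z]) zs
    else sample accept N out zs

/-- The state after `j` phases: the models trained so far, and the numbers of queries to the CoT
oracle and of calls to the ERM oracle. -/
structure State (M : Finset (Model Tok)) (j : ℕ) where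
  ens : Fin j → M
  cotQueries : ℕ
  ermCalls : ℕ

/-- Phase `j`: subsample the `j`-th of the `k` equal parts of the prompts by accepting `x` if
`η ≤ α_{rank(x)} / max_r α_r`, query the CoT oracle on the kept prompts, and train by log-loss
next-token prediction on the result. -/
noncomputable def phase (V : X → Tok → Bool) (erm : ERMOracle M X T) (N : ℕ) {n : ℕ}
    (ω : Fin n → X × Tape M T k m) {j : ℕ} (hj : j + 1 ≤ k) (S : State M j) : State M (j + 1) :=
  let part := ((List.ofFn ω).drop (j * (n / k))).take (n / k)
  let out := sample
    (fun z => z.2.1 ≤ alphaW k j (rankHat V (Nat.le_of_succ_le hj) S.ens z) / alphaMax k j) N [] part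
  let data : Fin out.length → X × (Fin T → Tok) := fun i => ((out.get i).1, (out.get i).2.2.1)
  { ens := Fin.snoc (α := fun _ => M) S.ens (erm.fit out.length data)
    cotQueries := S.cotQueries + out.length
    ermCalls := S.ermCalls + 1 }

/-- The state of the algorithm after `j ≤ k` phases. -/
noncomputable def run (V : X → Tok → Bool) (erm : ERMOracle M X T) (N : ℕ) {n : ℕ}
    (ω : Fin n → X × Tape M T k m) : (j : ℕ) → j ≤ k → State M j
  | 0, _ => { ens := Fin.elim0, cotQueries := 0, ermCalls := 0 }
  | j + 1, hj => phase V erm N ω hj (run V erm N ω j (Nat.le_of_succ_le hj))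

/-- The number of phases, `⌈C log(1/ε) / (1/400)²⌉`. -/
noncomputable def numPhases (C ε : ℝ) : ℕ := ⌈C * Real.log (1 / ε) / (1 / 400) ^ 2⌉₊

/-- `AutoTune_stoch`, run for `k` phases with base sample size `nPrompt c |M| (1/400) (δ/k)`:
its final state. -/
noncomputable def autoTune (V : X → Tok → Bool) (erm : ERMOracle M X T) (c δ : ℝ) {n : ℕ}
    (ω : Fin n → X × Tape M T k m) : State M k :=
  run V erm (nPrompt c M.card (1 / 400) (δ / k)) ω k le_rfl

/-- The uniform mixture `(1 / k) ∑_j π^j_T` of the outcome distributions of an ensemble. -/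
noncomputable def mixture [NeZero k] [NeZero T] (ens : Fin k → M) (x : X) : PMF Tok :=
  (PMF.uniformOfFintype (Fin k)).bind fun j => outcome (ens j).1 T x.1

/-- A polynomial in the logarithms of `u`, `v` and `w`. -/
noncomputable def polylog (A : ℝ) (a : ℕ) (u v w : ℝ) : ℝ :=
  A * (1 + Real.log u + Real.log v + Real.log w) ^ a

end Autocurriculum

open Autocurriculum

/-!
The argument is boosting by majority with rejection sampling, where the weak learner is maximum
likelihood.

*One phase.* Fix the ensemble before a phase, and let `W x` be the conditional mean of the weight
`α_{rank}` given the prompt `x`; the kept prompts are distributed with density proportional to `W`.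
Call a model `π` inadequate (`FailsPhase`) if `∫ W` is at least `ε / (100 k)` and the `W`-weighted
accuracy of `π` is below `1 - 1/400`. A log-loss minimizer is at least as likely on the data as the
teacher, so the product of the weights `R = (1 + p_π / p_*) / 2` over the kept prompts is at least
`1` (`one_le_prod_halfRatio`, as `R² ≥ p_π / p_*`). On the other hand the teacher only generates
chains of thought with accepted answers, so `R` has conditional mean at most `(1 + Acc_x(π)) / 2`
(`lintegral_halfRatio_le`), which for inadequate `π` is at most `799/800` on average. If `p` is the
probability that a prompt is kept, then the product over at most `N` kept prompts out of `L` has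
mean at most `(799/800)^N + (1 - p/800)^L`: this bound solves the recursion of the sampling procedure
(`lintegral_prod_sample_le`), and its second term covers the case that fewer than `N` prompts are
kept; as the weights `α` are at most `1`, `p ≥ ε / (100 k)`. Markov's inequality and a union bound over models and phases, for which the independence of
the blocks of prompts is used, show that with probability `1 - δ` no phase trains an inadequate
model (`inputLaw_exists_failsPhase_le`, `union_bound_le`).

*The potential.* Let `Φ_j` be the mean of `β_{rank}^{j,k}`, where the rank over the first `j` models
is estimated from fresh rollouts. The rank is a sum of conditionally independent Bernoulli variables,
and the recursion for `β` gives
`Φ_{j+1} - Φ_j = ∫ W x * (9/10 - P(estimated accuracy of π^j on x is at least 9/10))`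
(`meanRank_betaW_succ_sub`). By Markov's inequality for the estimated error the probability of
passing is at least `1 - 10 (1 - Acc_x(π^j))`, so a phase that does not fail increases the potential
by at most `ε / (100 k)` (`integral_drift_le`). The initial potential is the lower tail of a binomial
distribution, at most `0.96 ε` (`betaW_zero_le`), and the final one is the probability that the
rank is at most `4k/5`, which is thus at most `0.97 ε`.

*From ranks to accuracies.* Where the mixture has accuracy below `3/5`, the estimated rank is at most
`4k/5` with conditional probability at least `0.98`, by Chebyshev's inequality (`le_meanRank_betaW`).
Hence such prompts have probability at most `0.97 ε / 0.98 ≤ ε`.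
-/

set_option linter.unusedSectionVars false

namespace Autocurriculum

/-! ### Product measures -/

/-- Under a product measure, a set that depends only on the coordinates with `p` and a set that
depends only on the other coordinates are independent; neither has to be measurable. -/
theorem measure_pi_inter_of_dependsOn {ι : Type*} [Fintype ι] {α : ι → Type*}
    [∀ i, MeasurableSpace (α i)] (μ : ∀ i, Measure (α i)) [∀ i, IsProbabilityMeasure (μ i)]
    (p : ι → Prop) {A B : Set (∀ i, α i)}
    (hA : ∀ ω ω' : ∀ i, α i, (∀ i, p i → ω i = ω' i) → (ω ∈ A ↔ ω' ∈ A))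
    (hB : ∀ ω ω' : ∀ i, α i, (∀ i, ¬ p i → ω i = ω' i) → (ω ∈ B ↔ ω' ∈ B)) :
    Measure.pi μ (A ∩ B) = Measure.pi μ A * Measure.pi μ B := by
  classical
  have : ∀ i, Nonempty (α i) := fun i => nonempty_of_isProbabilityMeasure (μ i)
  obtain ⟨ω₀⟩ : Nonempty (∀ i, α i) := inferInstance
  set e := MeasurableEquiv.piEquivPiSubtypeProd α p
  have he := measurePreserving_piEquivPiSubtypeProd μ p
  set A' : Set (∀ i : { x // p x }, α i) := {u | e.symm (u, fun i => ω₀ i) ∈ A}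
  set B' : Set (∀ i : { x // ¬ p x }, α i) := {v | e.symm (fun i => ω₀ i, v) ∈ B}
  have hA' : A = e ⁻¹' (A' ×ˢ Set.univ) := by
    ext ω
    rw [Set.mem_preimage, Set.mem_prod]
    simp only [Set.mem_univ, and_true]
    refine hA _ _ fun i hi => ?_
    simp [e, MeasurableEquiv.piEquivPiSubtypeProd, Equiv.piEquivPiSubtypeProd, hi]
  have hB' : B = e ⁻¹' (Set.univ ×ˢ B') := by
    ext ω
    rw [Set.mem_preimage, Set.mem_prod]
    simp only [Set.mem_univ, true_and]
    refine hB _ _ fun i hi => ?_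
    simp [e, MeasurableEquiv.piEquivPiSubtypeProd, Equiv.piEquivPiSubtypeProd, hi]
  have hAB : A ∩ B = e ⁻¹' (A' ×ˢ B') := by
    rw [hA', hB', ← Set.preimage_inter, Set.prod_inter_prod, Set.univ_inter, Set.inter_univ]
  rw [hAB, hA', hB', he.measure_preimage_equiv, he.measure_preimage_equiv,
    he.measure_preimage_equiv, Measure.prod_prod, Measure.prod_prod, Measure.prod_prod,
    measure_univ, measure_univ, mul_one, one_mul]

/-- Selecting distinct coordinates of an i.i.d. family gives an i.i.d. family. -/
theorem measurePreserving_pi_comp {ι κ α : Type*} [Fintype ι] [Fintype κ] [MeasurableSpace α]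
    (μ : Measure α) [IsProbabilityMeasure μ] {f : κ → ι} (hf : Function.Injective f) :
    MeasurePreserving (fun (ω : ι → α) (i : κ) => ω (f i))
      (Measure.pi fun _ => μ) (Measure.pi fun _ => μ) := by
  classical
  have hm : Measurable (fun (ω : ι → α) (i : κ) => ω (f i)) := by fun_prop
  refine ⟨hm, (Measure.pi_eq fun s hs => ?_).symm⟩
  rw [Measure.map_apply hm (MeasurableSet.univ_pi hs)]
  have : (fun (ω : ι → α) (i : κ) => ω (f i)) ⁻¹' Set.univ.pi s =
      Set.univ.pi fun j => ⋂ i ∈ {i | f i = j}, s i := by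
    ext ω
    simp only [Set.mem_preimage, Set.mem_pi, Set.mem_univ, true_imp_iff, Set.mem_iInter,
      Set.mem_ofPred_eq]
    exact ⟨fun h j i hij => hij ▸ h i, fun h i => h _ i rfl⟩
  rw [this, Measure.pi_pi, ← Finset.prod_subset (Finset.subset_univ (Finset.univ.image f)),
    Finset.prod_image fun _ _ _ _ h => hf h]
  · refine Finset.prod_congr rfl fun i _ => ?_
    congr 1
    ext a
    simp only [Set.mem_iInter, Set.mem_ofPred_eq]
    exact ⟨fun h => h i rfl, fun h j hj => hf hj ▸ h⟩
  · intro j _ hj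
    have : (⋂ i ∈ {i | f i = j}, s i) = Set.univ := by
      refine Set.eq_univ_of_forall fun a => ?_
      simp only [Set.mem_iInter, Set.mem_ofPred_eq]
      exact fun i hi => (hj (Finset.mem_image.2 ⟨i, Finset.mem_univ _, hi⟩)).elim
    rw [this, measure_univ]

/-! ### Rejection sampling -/

section Sampling

variable {Z : Type*} {accept : Z → Prop} {R : Z → ℝ≥0∞}

theorem sample_eq_append (accept : Z → Prop) (N : ℕ) (out l : List Z) :
    sample accept N out l = out ++ sample accept (N - out.length) [] l := by
  induction l generalizing N out with
  | nil => simp [sample]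
  | cons z l ih =>
    by_cases h : N ≤ out.length
    · simp [sample, h]
    · have h' : ¬ N - out.length ≤ 0 := by omega
      by_cases hz : accept z
      · simp only [sample, h, h', hz, if_true, if_false, List.length_nil, List.nil_append]
        rw [ih N, ih (N - out.length) [z]]
        simp [Nat.sub_sub]
      · simp only [sample, h, h', hz, if_false, List.length_nil]
        exact ih N out

theorem length_sample_le (accept : Z → Prop) (N : ℕ) (l : List Z) :
    (sample accept N [] l).length ≤ N := by
  induction l generalizing N with
  | nil => simp [sample]
  | cons z l ih =>
    by_cases h : N = 0
    · simp [sample, h]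
    · by_cases hz : accept z
      · have := ih (N - 1)
        simp only [sample, hz, List.length_nil, Nat.le_zero, h, if_true, if_false,
          List.nil_append]
        rw [sample_eq_append]
        simp only [List.length_append, List.length_cons, List.length_nil, zero_add]
        omega
      · simp only [sample, hz, List.length_nil, Nat.le_zero, h, if_false]
        exact ih N

theorem sample_zero (l : List Z) : sample accept 0 [] l = [] :=
  List.eq_nil_of_length_eq_zero (Nat.le_zero.1 (length_sample_le accept 0 l))

open Classical in
theorem sample_succ_cons (N : ℕ) (z : Z) (l : List Z) :
    sample accept (N + 1) [] (z :: l) =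
      if accept z then z :: sample accept N [] l else sample accept (N + 1) [] l := by
  by_cases hz : accept z
  · simp only [sample, hz, if_true, List.length_nil, List.nil_append]
    rw [sample_eq_append]
    simp
  · simp [sample, hz]

variable [MeasurableSpace Z]

theorem measurable_prod_sample (hA : MeasurableSet {z | accept z}) (hR : Measurable R)
    (L N : ℕ) :
    Measurable fun ω : Fin L → Z => ((sample accept N [] (List.ofFn ω)).map R).prod := by
  classical
  induction L generalizing N with
  | zero => simp [sample]
  | succ L ih =>
    cases N with
    | zero => simp [sample_zero]
    | succ N =>
      simp only [List.ofFn_succ, sample_succ_cons, apply_ite (List.map R),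
        apply_ite List.prod, List.map_cons, List.prod_cons]
      refine Measurable.ite (measurable_pi_apply 0 hA) ?_ ?_
      · exact (hR.comp (measurable_pi_apply 0)).mul
          ((ih N).comp (measurable_pi_lambda _ fun i => measurable_pi_apply _))
      · exact (ih (N + 1)).comp (measurable_pi_lambda _ fun i => measurable_pi_apply _)

/-- Rejection sampling against a weight `R` whose mean on the accepted region is at most `lam`:
the expected product of the weights of the kept points is at most `lam ^ N`, the value if `N`
points are kept, plus a term that is exponentially small in the length of the input. -/
theorem lintegral_prod_sample_le (μ : Measure Z) [IsProbabilityMeasure μ]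
    (hA : MeasurableSet {z | accept z}) (hR : Measurable R) {lam : ℝ≥0∞}
    (h : ∫⁻ z in {z | accept z}, R z ∂μ ≤ lam * μ {z | accept z}) (L N : ℕ) :
    ∫⁻ ω, ((sample accept N [] (List.ofFn ω)).map R).prod ∂(Measure.pi fun _ : Fin L => μ) ≤
      lam ^ N + (μ {z | accept z}ᶜ + lam * μ {z | accept z}) ^ L := by
  classical
  set A := {z | accept z} with hAdef
  set q := μ Aᶜ + lam * μ A
  induction L generalizing N with
  | zero => simp [sample]
  | succ L ih =>
    cases N with
    | zero => simp [sample_zero]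
    | succ N =>
      set F : ℕ → (Fin L → Z) → ℝ≥0∞ := fun N ω =>
        ((sample accept N [] (List.ofFn ω)).map R).prod
      have hF : ∀ N, Measurable (F N) := measurable_prod_sample hA hR L
      set G : Z × (Fin L → Z) → ℝ≥0∞ := fun zω =>
        if accept zω.1 then R zω.1 * F N zω.2 else F (N + 1) zω.2
      have hG : Measurable G :=
        Measurable.ite (measurable_fst hA) ((hR.comp measurable_fst).mul
          ((hF N).comp measurable_snd)) ((hF (N + 1)).comp measurable_snd)
      have hmp := measurePreserving_piFinSuccAbove (fun _ : Fin (L + 1) => μ) 0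
      have hEq : ∀ ω : Fin (L + 1) → Z,
          ((sample accept (N + 1) [] (List.ofFn ω)).map R).prod =
            G (MeasurableEquiv.piFinSuccAbove (fun _ => Z) 0 ω) := by
        intro ω
        simp only [List.ofFn_succ, sample_succ_cons, apply_ite (List.map R),
          apply_ite List.prod, List.map_cons, List.prod_cons]
        rfl
      simp only [hEq]
      rw [hmp.lintegral_comp hG, lintegral_prod _ hG.aemeasurable,
        ← lintegral_add_compl _ hA]
      have h1 : ∫⁻ z in A, ∫⁻ ω, G (z, ω) ∂(Measure.pi fun _ : Fin L => μ) ∂μ ≤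
          lam * μ A * (lam ^ N + q ^ L) := by
        calc ∫⁻ z in A, ∫⁻ ω, G (z, ω) ∂(Measure.pi fun _ : Fin L => μ) ∂μ
            = ∫⁻ z in A, R z * ∫⁻ ω, F N ω ∂(Measure.pi fun _ : Fin L => μ) ∂μ := by
              refine setLIntegral_congr_fun hA fun z hz => ?_
              have hz' : accept z := hz
              simp only [G, hz', if_true]
              rw [lintegral_const_mul _ (hF N)]
          _ = (∫⁻ z in A, R z ∂μ) * ∫⁻ ω, F N ω ∂(Measure.pi fun _ : Fin L => μ) :=
              lintegral_mul_const _ hR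
          _ ≤ _ := mul_le_mul' h (ih N)
      have h2 : ∫⁻ z in Aᶜ, ∫⁻ ω, G (z, ω) ∂(Measure.pi fun _ : Fin L => μ) ∂μ ≤
          μ Aᶜ * (lam ^ (N + 1) + q ^ L) := by
        calc ∫⁻ z in Aᶜ, ∫⁻ ω, G (z, ω) ∂(Measure.pi fun _ : Fin L => μ) ∂μ
            = ∫⁻ z in Aᶜ, ∫⁻ ω, F (N + 1) ω ∂(Measure.pi fun _ : Fin L => μ) ∂μ := by
              refine setLIntegral_congr_fun hA.compl fun z hz => ?_
              have hz' : ¬ accept z := hz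
              simp only [G, hz', if_false]
          _ = (∫⁻ ω, F (N + 1) ω ∂(Measure.pi fun _ : Fin L => μ)) * μ Aᶜ := by simp
          _ ≤ _ := by rw [mul_comm]; exact mul_le_mul' le_rfl (ih (N + 1))
      -- Both `lam ^ N` and `q ^ L` solve the recursion that the mean satisfies.
      calc _ ≤ lam * μ A * (lam ^ N + q ^ L) + μ Aᶜ * (lam ^ (N + 1) + q ^ L) :=
            add_le_add h1 h2
        _ = (μ A + μ Aᶜ) * lam ^ (N + 1) + q ^ (L + 1) := by
            simp only [q]; ring
        _ = lam ^ (N + 1) + q ^ (L + 1) := by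
            rw [measure_add_measure_compl hA, measure_univ, one_mul]

end Sampling

/-! ### Likelihoods and the log-loss -/

section

variable {Tok : Type*} [MeasurableSpace Tok]

theorem cot_apply (π : Model Tok) (s : Str Tok) (T : ℕ) (y : Fin T → Tok) :
    cot π s T y = ∏ t : Fin T, π.next (s.append ((List.ofFn y).take t)) (y t) := by
  classical
  induction T with
  | zero =>
    rw [Subsingleton.elim y Fin.elim0]
    simp [cot]
  | succ T ih =>
    have hy : y = Fin.snoc (α := fun _ => Tok) (Fin.init y) (y (Fin.last T)) :=
      (Fin.snoc_init_self y).symm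
    have happ : List.ofFn y = List.ofFn (Fin.init y) ++ [y (Fin.last T)] := by
      rw [List.ofFn_succ', List.concat_eq_append]
      rfl
    have htake : ∀ t : Fin T, (List.ofFn y).take t = (List.ofFn (Fin.init y)).take t :=
      fun t => by rw [happ, List.take_append_of_le_length (by simp)]
    have hlast : (List.ofFn y).take T = List.ofFn (Fin.init y) := by
      rw [happ, List.take_left' (by simp)]
    rw [Fin.prod_univ_castSucc]
    simp only [Fin.val_castSucc, Fin.val_last, htake, hlast]
    have ih' := ih (Fin.init y)
    simp only [Fin.init] at ih' ⊢
    rw [← ih']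
    simp only [cot, PMF.bind_apply]
    rw [tsum_eq_single (Fin.init y)]
    · rw [PMF.map_apply, tsum_eq_single (y (Fin.last T))]
      · simp
      · intro a ha
        rw [if_neg]
        intro h
        apply ha
        rw [h]; simp
    · intro z hz
      rw [PMF.map_apply, ENNReal.tsum_eq_zero.2, mul_zero]
      intro a
      rw [if_neg]
      intro h
      apply hz
      rw [h]; simp

theorem ennreal_log_prod {ι : Type*} (s : Finset ι) (f : ι → ℝ≥0∞) :
    ENNReal.log (∏ i ∈ s, f i) = ∑ i ∈ s, ENNReal.log (f i) := by
  classical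
  induction s using Finset.induction_on with
  | empty => simp
  | insert a s ha ih => rw [Finset.prod_insert ha, Finset.sum_insert ha, ENNReal.log_mul_add, ih]

theorem ennreal_prod_inv {ι : Type*} (s : Finset ι) {f : ι → ℝ≥0∞} (hf : ∀ i ∈ s, f i ≠ ∞) :
    ∏ i ∈ s, (f i)⁻¹ = (∏ i ∈ s, f i)⁻¹ := by
  classical
  induction s using Finset.induction_on with
  | empty => simp
  | insert a s ha ih =>
    rw [Finset.prod_insert ha, Finset.prod_insert ha,
      ih fun i hi => hf i (Finset.mem_insert_of_mem hi), ENNReal.mul_inv]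
    · exact Or.inr (ENNReal.prod_ne_top fun i hi => hf i (Finset.mem_insert_of_mem hi))
    · exact Or.inl (hf a (Finset.mem_insert_self _ _))

variable {X : Set (Str Tok)} {T : ℕ}

theorem empLogLoss_eq {N : ℕ} (π : Model Tok) (D : Fin N → X × (Fin T → Tok)) :
    empLogLoss π D =
      (((N * T : ℝ)⁻¹ : ℝ) : EReal) * ENNReal.log (∏ i, cot π (D i).1.1 T (D i).2)⁻¹ := by
  have h : ∀ i, (cot π (D i).1.1 T (D i).2)⁻¹ =
      ∏ t : Fin T, (π.next ((D i).1.1.append ((List.ofFn (D i).2).take t)) ((D i).2 t))⁻¹ := by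
    intro i
    rw [cot_apply, ennreal_prod_inv _ fun t _ => PMF.apply_ne_top _ _]
  rw [empLogLoss, ← ennreal_prod_inv _ fun i _ => PMF.apply_ne_top _ _, ennreal_log_prod]
  simp only [h, ennreal_log_prod]

/-- A log-loss minimizer is a maximum-likelihood estimator. -/
theorem prod_cot_le_of_empLogLoss_le [NeZero T] {N : ℕ} {π π' : Model Tok}
    {D : Fin N → X × (Fin T → Tok)} (h : empLogLoss π D ≤ empLogLoss π' D) :
    ∏ i, cot π' (D i).1.1 T (D i).2 ≤ ∏ i, cot π (D i).1.1 T (D i).2 := by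
  rcases Nat.eq_zero_or_pos N with rfl | hN
  · simp
  have hpos : (0 : ℝ) < ((N * T : ℝ)⁻¹ : ℝ) := by
    have : 0 < T := NeZero.pos T
    positivity
  rw [empLogLoss_eq, empLogLoss_eq] at h
  rw [← ENNReal.inv_le_inv, ← ENNReal.log_le_log_iff]
  have h' := mul_le_mul_of_nonneg_left h (EReal.coe_nonneg.2 (inv_nonneg.2 hpos.le))
  rwa [← mul_assoc, ← mul_assoc, ← EReal.coe_mul, inv_mul_cancel₀ hpos.ne', EReal.coe_one, one_mul,
    one_mul] at h'

open Classical in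
/-- The weight `(1 + p_π / p_π') / 2` of a chain of thought, infinite where `p_π'` vanishes. It
stands in for the square root of the likelihood ratio, which it dominates by the inequality of
arithmetic and geometric means. -/
noncomputable def halfRatio (π π' : Model Tok) (x : X) (y : Fin T → Tok) : ℝ≥0∞ :=
  if cot π' x.1 T y = 0 then ∞ else (1 + cot π x.1 T y / cot π' x.1 T y) / 2

theorem halfRatio_ne_zero (π π' : Model Tok) (x : X) (y : Fin T → Tok) :
    halfRatio π π' x y ≠ 0 := by
  unfold halfRatio
  split_ifs <;> simp

theorem ennreal_le_sq_half_one_add (r : ℝ≥0∞) : r ≤ ((1 + r) / 2) ^ 2 := by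
  rcases eq_or_ne r ∞ with rfl | hr
  · simp [ENNReal.top_div]
  lift r to NNReal using hr
  have : (r : ℝ≥0∞) ≤ ((((1 + r) / 2) ^ 2 : NNReal) : ℝ≥0∞) := by
    rw [ENNReal.coe_le_coe, ← NNReal.coe_le_coe]
    push_cast
    nlinarith [sq_nonneg ((r : ℝ) - 1)]
  simpa using this

/-- If `π` is at least as likely as `π'` on the data, then the weights multiply to at least `1`. -/
theorem one_le_prod_halfRatio {N : ℕ} {π π' : Model Tok} {D : Fin N → X × (Fin T → Tok)}
    (h : ∏ i, cot π' (D i).1.1 T (D i).2 ≤ ∏ i, cot π (D i).1.1 T (D i).2) :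
    1 ≤ ∏ i, halfRatio π π' (D i).1 (D i).2 := by
  classical
  by_cases hpos : ∀ i, cot π' (D i).1.1 T (D i).2 ≠ 0
  swap
  · push Not at hpos
    obtain ⟨i, hi⟩ := hpos
    rw [← Finset.mul_prod_erase _ _ (Finset.mem_univ i), halfRatio, if_pos hi, ENNReal.top_mul]
    · exact le_top
    · exact Finset.prod_ne_zero_iff.2 fun i _ => halfRatio_ne_zero _ _ _ _
  have h1 : (1 : ℝ≥0∞) ≤ ∏ i, (cot π (D i).1.1 T (D i).2 / cot π' (D i).1.1 T (D i).2) := by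
    simp only [div_eq_mul_inv]
    rw [Finset.prod_mul_distrib, ennreal_prod_inv _ fun i _ => PMF.apply_ne_top _ _,
      ← div_eq_mul_inv, ENNReal.le_div_iff_mul_le, one_mul]
    · exact h
    · exact Or.inl (Finset.prod_ne_zero_iff.2 fun i _ => hpos i)
    · exact Or.inl (ENNReal.prod_ne_top fun i _ => PMF.apply_ne_top _ _)
  have h2 : (1 : ℝ≥0∞) ≤ (∏ i, halfRatio π π' (D i).1 (D i).2) ^ 2 := by
    refine h1.trans ?_
    rw [← Finset.prod_pow]
    refine Finset.prod_le_prod' fun i _ => ?_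
    rw [halfRatio, if_neg (hpos i)]
    exact ennreal_le_sq_half_one_add _
  by_contra hlt
  exact absurd h2 (not_le.2 (pow_lt_one₀ (zero_le) (not_le.1 hlt) two_ne_zero))

/-! ### Accuracies -/

variable [Fintype Tok]

theorem accAt_le_one {S : Type*} [Fintype S] {X : Set (Str S)} (V : X → S → Bool) (f : X → PMF S) (x : X) : accAt V f x ≤ 1 := by
  rw [accAt, ← (f x).tsum_coe, tsum_fintype]
  exact Finset.sum_le_sum fun a _ => by split_ifs <;> simp

theorem accAt_ne_top {S : Type*} [Fintype S] {X : Set (Str S)} (V : X → S → Bool) (f : X → PMF S) (x : X) : accAt V f x ≠ ∞ :=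
  ne_top_of_le_ne_top ENNReal.one_ne_top (accAt_le_one V f x)

/-- The accuracy of a model as a sum over chains of thought. -/
theorem accAt_outcome (V : X → Tok → Bool) (π : Model Tok) [NeZero T] (x : X) :
    accAt V (fun x => outcome π T x.1) x =
      ∑ y : Fin T → Tok, if V x (y (lastPos T)) = true then cot π x.1 T y else 0 := by
  classical
  simp only [accAt, outcome, PMF.map_apply, tsum_fintype]
  rw [← Finset.sum_fiberwise (Finset.univ) (fun y : Fin T → Tok => y (lastPos T))]
  refine Finset.sum_congr rfl fun a _ => ?_
  rw [Finset.sum_filter]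
  split_ifs with h
  · refine Finset.sum_congr rfl fun y _ => ?_
    by_cases hy : a = y (lastPos T)
    · simp [hy.symm, h]
    · simp [hy, Ne.symm hy]
  · symm
    refine Finset.sum_eq_zero fun y _ => ?_
    split_ifs with h1 h2
    · exact (h (h1 ▸ h2)).elim
    · rfl
    · rfl

theorem measurable_accAt_outcome [DiscreteMeasurableSpace Tok] {V : X → Tok → Bool}
    (hV : ∀ y, MeasurableSet {x | V x y = true}) (π : Model Tok) [NeZero T] :
    Measurable fun x : X => accAt V (fun x => outcome π T x.1) x :=
  Finset.measurable_sum _ fun a _ => Measurable.ite (hV a)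
    ((measurable_outcome π T a).comp measurable_subtype_coe) measurable_const

/-- A model of average accuracy one is almost surely perfectly accurate. -/
theorem ae_accAt_eq_one [DiscreteMeasurableSpace Tok] {ρ : Measure X} [IsProbabilityMeasure ρ]
    {V : X → Tok → Bool} (π : Model Tok) [NeZero T]
    (h : acc ρ V (fun x => outcome π T x.1) = 1) :
    ∀ᵐ x ∂ρ, accAt V (fun x => outcome π T x.1) x = 1 := by
  have := ae_eq_of_ae_le_of_lintegral_le (μ := ρ)
    (Filter.Eventually.of_forall fun x => accAt_le_one V (fun x => outcome π T x.1) x)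
    (by change acc ρ V _ ≠ ∞; simp [h]) aemeasurable_const
    (by change _ ≤ acc ρ V _; simp [h])
  exact this

/-- The mean of the weight under a perfectly accurate teacher: a perfectly accurate teacher only
generates chains with accepted answers, and `π` generates these with probability `Acc_x(π)`. -/
theorem lintegral_halfRatio_le [DiscreteMeasurableSpace Tok] (V : X → Tok → Bool)
    (π π' : Model Tok) [NeZero T] (x : X)
    (h : accAt V (fun x => outcome π' T x.1) x = 1) :
    ∫⁻ y, halfRatio π π' x y ∂(cotKernel π' X T x) ≤
      (1 + accAt V (fun x => outcome π T x.1) x) / 2 := by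
  classical
  have hsupp : ∀ y, cot π' x.1 T y ≠ 0 → V x (y (lastPos T)) = true := by
    intro y hy
    by_contra hV
    have h1 : ∑ y : Fin T → Tok, cot π' x.1 T y = 1 := by
      rw [← (cot π' x.1 T).tsum_coe, tsum_fintype]
    have h2 : ∑ y : Fin T → Tok, cot π' x.1 T y =
        (∑ y : Fin T → Tok, if V x (y (lastPos T)) = true then cot π' x.1 T y else 0) +
        ∑ y : Fin T → Tok, if V x (y (lastPos T)) = true then 0 else cot π' x.1 T y := by
      rw [← Finset.sum_add_distrib]
      exact Finset.sum_congr rfl fun y _ => by split_ifs <;> simp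
    rw [← accAt_outcome, h, h1] at h2
    have h3 := (ENNReal.add_right_inj ENNReal.one_ne_top).1 ((add_zero 1).trans h2).symm
    have h4 := (Finset.sum_eq_zero_iff.1 h3) y (Finset.mem_univ y)
    rw [if_neg hV] at h4
    exact hy h4
  change ∫⁻ y, halfRatio π π' x y ∂(cot π' x.1 T).toMeasure ≤ _
  rw [lintegral_fintype]
  simp only [PMF.toMeasure_apply_singleton _ _ (measurableSet_singleton _)]
  have h1 : ∑ y : Fin T → Tok, cot π' x.1 T y = 1 := by
    rw [← (cot π' x.1 T).tsum_coe, tsum_fintype]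
  calc ∑ y, halfRatio π π' x y * cot π' x.1 T y
      ≤ ∑ y, (cot π' x.1 T y +
          if V x (y (lastPos T)) = true then cot π x.1 T y else 0) / 2 := by
        refine Finset.sum_le_sum fun y _ => ?_
        by_cases hy : cot π' x.1 T y = 0
        · simp [hy]
        · rw [if_pos (hsupp y hy), halfRatio, if_neg hy, div_eq_mul_inv, mul_right_comm, add_mul, one_mul,
            ENNReal.div_mul_cancel hy (PMF.apply_ne_top _ _), div_eq_mul_inv]
    _ = _ := by
        simp only [div_eq_mul_inv]
        rw [← Finset.sum_mul, Finset.sum_add_distrib, h1, accAt_outcome]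

end

/-! ### The weights -/

theorem betaW_succ_le (k i r : ℕ) : betaW k i (r + 1) ≤ betaW k i r := by
  induction i generalizing r with
  | zero =>
    simp only [betaW]
    split_ifs with h1 h2
    · exact le_rfl
    · exact (h2 (le_trans (by push_cast; linarith) h1)).elim
    · exact zero_le_one
    · exact le_rfl
  | succ i ih =>
    simp only [betaW]
    linarith [ih r, ih (r + 1)]

theorem betaW_nonneg (k i r : ℕ) : 0 ≤ betaW k i r := by
  induction i generalizing r with
  | zero => simp only [betaW]; split_ifs <;> norm_num
  | succ i ih => simp only [betaW]; linarith [ih r, ih (r + 1)]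

theorem betaW_le_one (k i r : ℕ) : betaW k i r ≤ 1 := by
  induction i generalizing r with
  | zero => simp only [betaW]; split_ifs <;> norm_num
  | succ i ih => simp only [betaW]; linarith [ih r, ih (r + 1)]

theorem alphaW_nonneg (k j r : ℕ) : 0 ≤ alphaW k j r :=
  sub_nonneg.2 (betaW_succ_le _ _ _)

theorem alphaW_le_one (k j r : ℕ) : alphaW k j r ≤ 1 := by
  have := betaW_le_one k (k - (j + 1)) r
  have := betaW_nonneg k (k - (j + 1)) (r + 1)
  unfold alphaW; linarith

theorem alphaW_le_alphaMax {k j r : ℕ} (h : r ≤ j) : alphaW k j r ≤ alphaMax k j :=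
  Finset.le_sup' (alphaW k j) (Finset.mem_range.2 (Nat.lt_succ_of_le h))

theorem alphaMax_le_one (k j : ℕ) : alphaMax k j ≤ 1 :=
  Finset.sup'_le _ _ fun r _ => alphaW_le_one k j r

theorem alphaMax_nonneg (k j : ℕ) : 0 ≤ alphaMax k j :=
  (alphaW_nonneg k j 0).trans (alphaW_le_alphaMax (Nat.zero_le _))

/-- The exponential-moment bound for the lower tail of a binomial variable with success
probability `9/10`; the base `6/5` is close to optimal. -/
theorem betaW_le_exp_moment (k i r : ℕ) :
    betaW k i r ≤
      (6 / 5 : ℝ) ^ (4 * k) * ((5 / 6 : ℝ) ^ 5) ^ r * (1 / 10 + 9 / 10 * (5 / 6 : ℝ) ^ 5) ^ i := by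
  induction i generalizing r with
  | zero =>
    simp only [betaW, pow_zero, mul_one]
    split_ifs with h
    · have hr : 5 * r ≤ 4 * k := by
        have : (5 * r : ℝ) ≤ 4 * k := by linarith
        exact_mod_cast this
      rw [← pow_mul]
      have h1 : (6 / 5 : ℝ) ^ (5 * r) * (5 / 6 : ℝ) ^ (5 * r) = 1 := by
        rw [← mul_pow]; norm_num
      rw [← h1]
      gcongr
      norm_num
    · positivity
  | succ i ih =>
    simp only [betaW]
    have h1 := ih r
    have h2 := ih (r + 1)
    calc _ ≤ 1 / 10 * ((6 / 5 : ℝ) ^ (4 * k) * ((5 / 6 : ℝ) ^ 5) ^ r *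
            (1 / 10 + 9 / 10 * (5 / 6 : ℝ) ^ 5) ^ i) +
          (1 - 1 / 10) * ((6 / 5 : ℝ) ^ (4 * k) * ((5 / 6 : ℝ) ^ 5) ^ (r + 1) *
            (1 / 10 + 9 / 10 * (5 / 6 : ℝ) ^ 5) ^ i) := by gcongr
      _ = _ := by ring

/-- The initial potential is at most `0.96 ε` as soon as `k ≥ 160000 log (1 / ε)`. For `ε` near `1`
this allows `k = 1`, so the bound has to hold without any slack in the number of phases. -/
theorem betaW_zero_le {k : ℕ} (hk : 1 ≤ k) {ε : ℝ} (hε : 0 < ε)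
    (h : 160000 * Real.log ε⁻¹ ≤ k) : betaW k k 0 ≤ 96 / 100 * ε := by
  have h1 : betaW k k 0 ≤ (958 / 1000 : ℝ) ^ k := by
    refine (betaW_le_exp_moment k k 0).trans ?_
    rw [pow_zero, mul_one, pow_mul, ← mul_pow]
    gcongr
    norm_num
  have hexp : Real.exp (1 / 160000) ≤ 1001 / 1000 := by
    have := Real.exp_bound_div_one_sub_of_interval (x := 1 / 160000) (by norm_num) (by norm_num)
    refine this.trans (by norm_num)
  have h2 : Real.exp (-(k / 160000)) ≤ ε := by
    rw [← Real.le_log_iff_exp_le hε]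
    rw [Real.log_inv] at h
    linarith
  have h3 : (958 / 1000 * Real.exp (1 / 160000) : ℝ) ^ k ≤ 96 / 100 := by
    calc (958 / 1000 * Real.exp (1 / 160000) : ℝ) ^ k ≤ (96 / 100) ^ k := by
          gcongr
          nlinarith
      _ ≤ (96 / 100) ^ 1 := pow_le_pow_of_le_one (by norm_num) (by norm_num) hk
      _ = _ := pow_one _
  calc betaW k k 0 ≤ (958 / 1000 : ℝ) ^ k := h1
    _ = (958 / 1000 * Real.exp (1 / 160000) : ℝ) ^ k * Real.exp (-(k / 160000)) := by
      rw [mul_pow, ← Real.exp_nat_mul, mul_assoc, ← Real.exp_add]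
      ring_nf
      simp
    _ ≤ 96 / 100 * ε := by gcongr

/-! ### Estimated ranks at a fixed prompt -/

section

variable {Tok : Type*} [MeasurableSpace Tok] [Fintype Tok] {X : Set (Str Tok)}
  {M : Finset (Model Tok)} {k : ℕ}

/-- The estimated rank as a function of the prompt and of the rollouts alone. -/
noncomputable def rankOf (V : X → Tok → Bool) {m j : ℕ} (hj : j ≤ k) (ens : Fin j → M) (x : X)
    (Y : Fin k × M × Fin m → Tok) : ℕ :=
  ∑ r : Fin j, if 9 / 10 ≤ accHat V x (fun i => Y (Fin.castLE hj r, ens r, i)) then 1 else 0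

theorem rankOf_le (V : X → Tok → Bool) {m j : ℕ} (hj : j ≤ k) (ens : Fin j → M) (x : X)
    (Y : Fin k × M × Fin m → Tok) : rankOf V hj ens x Y ≤ j := by
  calc rankOf V hj ens x Y ≤ ∑ _r : Fin j, 1 :=
        Finset.sum_le_sum fun r _ => by split_ifs <;> simp
    _ = j := by simp

variable [DiscreteMeasurableSpace Tok] (T m : ℕ) [NeZero T]

/-- The conditional mean of `f (rank)` given the prompt `x`. -/
noncomputable def meanRank (V : X → Tok → Bool) {j : ℕ} (hj : j ≤ k) (ens : Fin j → M)
    (f : ℕ → ℝ) (x : X) : ℝ :=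
  ∫ Y, f (rankOf V hj ens x Y) ∂(rolloutKernel M X T k m x)

/-- The conditional probability, given the prompt `x`, that the estimated accuracy of the model
`π`, as the `r`-th of the ensemble, is at least `9/10`. -/
noncomputable def passProb (V : X → Tok → Bool) (r : Fin k) (π : M) (x : X) : ℝ :=
  (rolloutKernel M X T k m x).real {Y | 9 / 10 ≤ accHat V x fun i => Y (r, π, i)}

variable (V : X → Tok → Bool)

theorem passProb_nonneg (r : Fin k) (π : M) (x : X) : 0 ≤ passProb T m V r π x :=
  measureReal_nonneg

theorem passProb_le_one (r : Fin k) (π : M) (x : X) : passProb T m V r π x ≤ 1 :=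
  measureReal_le_one

theorem meanRank_nonneg {j : ℕ} (hj : j ≤ k) (ens : Fin j → M) {f : ℕ → ℝ}
    (hf : ∀ s, 0 ≤ f s) (x : X) : 0 ≤ meanRank T m V hj ens f x :=
  integral_nonneg fun _ => hf _

theorem meanRank_le_one {j : ℕ} (hj : j ≤ k) (ens : Fin j → M) {f : ℕ → ℝ}
    (hf : ∀ s, f s ≤ 1) (x : X) : meanRank T m V hj ens f x ≤ 1 := by
  calc meanRank T m V hj ens f x ≤ ∫ _, 1 ∂(rolloutKernel M X T k m x) :=
        integral_mono Integrable.of_finite (integrable_const _) fun _ => hf _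
    _ = 1 := by simp

theorem meanRank_add {j : ℕ} (hj : j ≤ k) (ens : Fin j → M) (f g : ℕ → ℝ) (x : X) :
    meanRank T m V hj ens (fun s => f s + g s) x =
      meanRank T m V hj ens f x + meanRank T m V hj ens g x :=
  integral_add Integrable.of_finite Integrable.of_finite

theorem meanRank_sub {j : ℕ} (hj : j ≤ k) (ens : Fin j → M) (f g : ℕ → ℝ) (x : X) :
    meanRank T m V hj ens (fun s => f s - g s) x =
      meanRank T m V hj ens f x - meanRank T m V hj ens g x :=
  integral_sub Integrable.of_finite Integrable.of_finite

theorem meanRank_const_mul {j : ℕ} (hj : j ≤ k) (ens : Fin j → M) (c : ℝ) (f : ℕ → ℝ) (x : X) :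
    meanRank T m V hj ens (fun s => c * f s) x = c * meanRank T m V hj ens f x :=
  integral_const_mul _ _

/-- The `j`-th estimate uses rollouts that the rank over the first `j` models does not use, so the
rank evolves as a sum of independent Bernoulli variables. -/
theorem meanRank_succ {j : ℕ} (hj : j + 1 ≤ k) (ens : Fin k → M) (f : ℕ → ℝ) (x : X) :
    meanRank T m V hj (fun r => ens (Fin.castLE hj r)) f x =
      (1 - passProb T m V ⟨j, hj⟩ (ens ⟨j, hj⟩) x) *
          meanRank T m V (Nat.le_of_succ_le hj)
            (fun r => ens (Fin.castLE (Nat.le_of_succ_le hj) r)) f x +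
        passProb T m V ⟨j, hj⟩ (ens ⟨j, hj⟩) x *
          meanRank T m V (Nat.le_of_succ_le hj)
            (fun r => ens (Fin.castLE (Nat.le_of_succ_le hj) r)) (fun s => f (s + 1)) x := by
  classical
  set μ := rolloutKernel M X T k m x with hμ
  set hj' := Nat.le_of_succ_le hj
  set ens' : Fin j → M := fun r => ens (Fin.castLE hj' r)
  set q : Fin k × M := (⟨j, hj⟩, ens ⟨j, hj⟩)
  set B : Set (Fin k × M × Fin m → Tok) := {Y | 9 / 10 ≤ accHat V x fun i => Y (q.1, q.2, i)}
  set b : (Fin k × M × Fin m → Tok) → ℝ := B.indicator fun _ => 1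
  have hrank : ∀ Y : Fin k × M × Fin m → Tok, rankOf V hj (fun r => ens (Fin.castLE hj r)) x Y =
      rankOf V hj' ens' x Y + if Y ∈ B then 1 else 0 := by
    intro Y
    rw [rankOf, Fin.sum_univ_castSucc]
    rfl
  have hind : IndepFun (fun Y => rankOf V hj' ens' x Y) b μ := by
    rw [indepFun_iff_measure_inter_preimage_eq_mul]
    intro s t _ _
    refine measure_pi_inter_of_dependsOn _ (fun i => i.1.val < j) ?_ ?_
    · intro ω ω' h
      have : rankOf V hj' ens' x ω = rankOf V hj' ens' x ω' := by
        refine Finset.sum_congr rfl fun r _ => ?_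
        have : (fun i : Fin m => ω (Fin.castLE hj' r, ens' r, i)) =
            fun i => ω' (Fin.castLE hj' r, ens' r, i) := funext fun i => h _ r.2
        rw [this]
      simp only [Set.mem_preimage, this]
    · intro ω ω' h
      have : (fun i : Fin m => ω (q.1, q.2, i)) = fun i => ω' (q.1, q.2, i) :=
        funext fun i => h _ (lt_irrefl j)
      have : b ω = b ω' := by
        simp only [b, B, Set.indicator_apply, Set.mem_ofPred_eq, this]
      simp only [Set.mem_preimage, this]
  have hb : ∫ Y, b Y ∂μ = passProb T m V ⟨j, hj⟩ (ens ⟨j, hj⟩) x := by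
    rw [integral_indicator_const _ (Set.toFinite B).measurableSet]
    simp [passProb, hμ, B, q]
  have hmul : ∀ g : ℕ → ℝ, ∫ Y, g (rankOf V hj' ens' x Y) * b Y ∂μ =
      meanRank T m V hj' ens' g x * passProb T m V ⟨j, hj⟩ (ens ⟨j, hj⟩) x := by
    intro g
    rw [← hb]
    exact (hind.comp (φ := g) (ψ := id) (measurable_of_countable _)
      measurable_id).integral_fun_mul_eq_mul_integral
      (measurable_of_finite _).aestronglyMeasurable (measurable_of_finite _).aestronglyMeasurable
  have hsplit : ∀ Y, f (rankOf V hj (fun r => ens (Fin.castLE hj r)) x Y) =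
      (f (rankOf V hj' ens' x Y) - f (rankOf V hj' ens' x Y) * b Y) +
        f (rankOf V hj' ens' x Y + 1) * b Y := by
    intro Y
    rw [hrank]
    by_cases hY : Y ∈ B <;> simp [b, hY]
  rw [meanRank]
  simp only [hsplit]
  rw [integral_add Integrable.of_finite Integrable.of_finite,
    integral_sub Integrable.of_finite Integrable.of_finite, hmul,
    hmul fun s => f (s + 1)]
  simp only [meanRank]
  ring

/-- The drift of the boosting potential in phase `j`. -/
theorem meanRank_betaW_succ_sub {j : ℕ} (hj : j + 1 ≤ k) (ens : Fin k → M) (x : X) :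
    meanRank T m V hj (fun r => ens (Fin.castLE hj r)) (betaW k (k - (j + 1))) x -
        meanRank T m V (Nat.le_of_succ_le hj)
          (fun r => ens (Fin.castLE (Nat.le_of_succ_le hj) r)) (betaW k (k - j)) x =
      (9 / 10 - passProb T m V ⟨j, hj⟩ (ens ⟨j, hj⟩) x) *
        meanRank T m V (Nat.le_of_succ_le hj)
          (fun r => ens (Fin.castLE (Nat.le_of_succ_le hj) r)) (alphaW k j) x := by
  have h1 : betaW k (k - j) = fun s => 1 / 10 * betaW k (k - (j + 1)) s +
      (1 - 1 / 10) * betaW k (k - (j + 1)) (s + 1) := by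
    have : k - j = k - (j + 1) + 1 := by omega
    rw [this]
    rfl
  have h2 : alphaW k j = fun s => betaW k (k - (j + 1)) s - betaW k (k - (j + 1)) (s + 1) := rfl
  rw [meanRank_succ, h1, meanRank_add, meanRank_const_mul,
    meanRank_const_mul T m V _ _ _ (fun s => betaW k (k - (j + 1)) (s + 1)), h2,
    meanRank_sub T m V _ _ (betaW k (k - (j + 1)))]
  ring

/-! ### Accuracy estimates at a fixed prompt -/

/-- The accuracy of a model of the class, as a real number. -/
noncomputable def accReal (π : Model Tok) (x : X) : ℝ :=
  (accAt V (fun x => outcome π T x.1) x).toReal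

theorem accReal_nonneg (π : Model Tok) (x : X) : 0 ≤ accReal T V π x := ENNReal.toReal_nonneg

theorem accReal_le_one (π : Model Tok) (x : X) : accReal T V π x ≤ 1 :=
  ENNReal.toReal_le_of_le_ofReal zero_le_one (by simpa using accAt_le_one V _ x)

/-- The indicator that the rollout with index `q` is accepted. -/
noncomputable def hit (x : X) (q : Fin k × M × Fin m) (Y : Fin k × M × Fin m → Tok) : ℝ :=
  if V x (Y q) = true then 1 else 0

variable {T m} in
theorem accHat_eq_sum_hit (x : X) (r : Fin k) (π : M) (Y : Fin k × M × Fin m → Tok) :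
    accHat V x (fun i => Y (r, π, i)) = (∑ i : Fin m, hit m V x (r, π, i) Y) / m := rfl

theorem integral_hit (x : X) (q : Fin k × M × Fin m) :
    ∫ Y, hit m V x q Y ∂(rolloutKernel M X T k m x) = accReal T V q.2.1.1 x := by
  classical
  have hmp := measurePreserving_eval
    (fun q : Fin k × M × Fin m => (outcome q.2.1.1 T x.1).toMeasure) q
  set g : Tok → ℝ := fun a => if V x a = true then 1 else 0
  have hmap := integral_map
    (μ := Measure.pi fun q : Fin k × M × Fin m => (outcome q.2.1.1 T x.1).toMeasure)
    hmp.measurable.aemeasurable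
    (f := g) (measurable_of_finite g).aestronglyMeasurable
  rw [hmp.map_eq] at hmap
  refine hmap.symm.trans ?_
  rw [integral_fintype Integrable.of_finite, accReal, accAt, ENNReal.toReal_sum]
  · refine Finset.sum_congr rfl fun a _ => ?_
    rw [measureReal_def, PMF.toMeasure_apply_singleton _ _ (measurableSet_singleton _)]
    by_cases h : V x a = true <;> simp [g, h]
  · intro a _
    split_ifs
    · exact PMF.apply_ne_top _ _
    · exact ENNReal.zero_ne_top

/-- Markov's inequality for the estimated error of one model. -/
theorem one_sub_passProb_le (hm : 0 < m) (r : Fin k) (π : M) (x : X) :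
    1 - passProb T m V r π x ≤ 10 * (1 - accReal T V π.1 x) := by
  set μ := rolloutKernel M X T k m x with hμ
  have hm' : (m : ℝ) ≠ 0 := by exact_mod_cast hm.ne'
  have hint : ∫ Y, (1 - accHat V x fun i => Y (r, π, i)) ∂μ = 1 - accReal T V π.1 x := by
    rw [integral_sub (integrable_const _) Integrable.of_finite]
    simp only [accHat_eq_sum_hit]
    rw [integral_div, integral_finsetSum _ fun _ _ => Integrable.of_finite]
    simp only [hμ, integral_hit]
    simp [hm']
  have hle : ∀ Y : Fin k × M × Fin m → Tok, accHat V x (fun i => Y (r, π, i)) ≤ 1 := by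
    intro Y
    rw [accHat_eq_sum_hit, div_le_one (by positivity)]
    calc ∑ i : Fin m, hit m V x (r, π, i) Y ≤ ∑ _i : Fin m, (1 : ℝ) :=
          Finset.sum_le_sum fun i _ => by unfold hit; split_ifs <;> norm_num
      _ = m := by simp
  have hmarkov := mul_meas_ge_le_integral_of_nonneg (μ := μ)
    (f := fun Y => 1 - accHat V x fun i => Y (r, π, i))
    (Filter.Eventually.of_forall fun Y => sub_nonneg.2 (hle Y)) Integrable.of_finite (1 / 10)
  have hcompl : 1 - passProb T m V r π x =
      μ.real {Y | 9 / 10 ≤ accHat V x fun i => Y (r, π, i)}ᶜ := by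
    rw [probReal_compl_eq_one_sub (Set.toFinite _).measurableSet]
    rfl
  have hsub : μ.real {Y | 9 / 10 ≤ accHat V x fun i => Y (r, π, i)}ᶜ ≤
      μ.real {Y | 1 / 10 ≤ 1 - accHat V x fun i => Y (r, π, i)} := by
    refine measureReal_mono fun Y hY => ?_
    have : ¬ 9 / 10 ≤ accHat V x fun i => Y (r, π, i) := hY
    change 1 / 10 ≤ 1 - accHat V x fun i => Y (r, π, i)
    linarith
  rw [hcompl]
  rw [hint] at hmarkov
  linarith

theorem accAt_mixture [NeZero k] (ens : Fin k → M) (x : X) :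
    (accAt V (mixture (T := T) ens) x).toReal = (∑ r, accReal T V (ens r).1 x) / k := by
  classical
  have h : accAt V (mixture (T := T) ens) x =
      ∑ r, (k : ℝ≥0∞)⁻¹ * accAt V (fun x => outcome (ens r).1 T x.1) x := by
    simp only [accAt, mixture, PMF.bind_apply, tsum_fintype, Finset.mul_sum]
    rw [Finset.sum_comm]
    refine Finset.sum_congr rfl fun a _ => ?_
    split_ifs <;> simp
  rw [h, ENNReal.toReal_sum fun r _ => ENNReal.mul_ne_top (by simp [NeZero.ne k])
    (accAt_ne_top V _ x), Finset.sum_div]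
  exact Finset.sum_congr rfl fun r _ => by
    simp [ENNReal.toReal_mul, accReal, div_eq_inv_mul]

/-- If the mixture has accuracy less than `3/5` at `x`, then it is very unlikely that more than
four fifths of the models of the ensemble pass their tests, since these would contribute accepted
rollouts at a rate of at least `4/5 * 9/10 = 18/25`. -/
theorem le_meanRank_betaW [NeZero k] (hm : 1000 ≤ m) (ens : Fin k → M) (x : X)
    (h : (accAt V (mixture (T := T) ens) x).toReal < 3 / 5) :
    98 / 100 ≤ meanRank T m V le_rfl ens (betaW k 0) x := by
  classical
  set μ := rolloutKernel M X T k m x with hμ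
  have hk : (0 : ℝ) < k := by exact_mod_cast NeZero.pos k
  have hm' : (1000 : ℝ) ≤ m := by exact_mod_cast hm
  have hm0 : (0 : ℝ) < m := by linarith
  set e : Fin k × Fin m → Fin k × M × Fin m := fun q => (q.1, ens q.1, q.2)
  have he : Function.Injective e := by
    rintro ⟨a, b⟩ ⟨c, d⟩ h
    simp only [e, Prod.mk.injEq] at h
    exact Prod.ext h.1 h.2.2
  set S : (Fin k × M × Fin m → Tok) → ℝ := fun Y => ∑ q, hit m V x (e q) Y
  have hS : ∫ Y, S Y ∂μ = m * ∑ r, accReal T V (ens r).1 x := by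
    simp only [S]
    rw [integral_finsetSum _ fun _ _ => Integrable.of_finite]
    simp only [hμ, integral_hit, e]
    rw [Fintype.sum_prod_type, Finset.mul_sum]
    simp
  have hmean : ∫ Y, S Y ∂μ ≤ 3 / 5 * (k * m) := by
    rw [accAt_mixture, div_lt_iff₀ hk] at h
    rw [hS]
    nlinarith
  have hind : iIndepFun (fun q => hit m V x (e q)) μ := by
    have := iIndepFun_pi (μ := fun q : Fin k × M × Fin m => (outcome q.2.1.1 T x.1).toMeasure)
      (X := fun _ a => if V x a = true then (1 : ℝ) else 0)
      (fun _ => (measurable_of_finite _).aemeasurable)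
    exact this.precomp he
  have hvar : Var[S; μ] ≤ k * m / 4 := by
    have h1 : S = ∑ q, hit m V x (e q) := by
      ext Y; simp [S]
    rw [h1, IndepFun.variance_sum (fun _ _ => MemLp.of_discrete)
      (fun a _ b _ hab => hind.indepFun hab)]
    calc ∑ q, Var[hit m V x (e q); μ] ≤ ∑ _q : Fin k × Fin m, (1 / 4 : ℝ) := by
          refine Finset.sum_le_sum fun q _ => ?_
          have := variance_le_sq_of_bounded (μ := μ) (a := 0) (b := 1) (X := hit m V x (e q))
            (Filter.Eventually.of_forall fun Y => by
              unfold hit; split_ifs <;> simp) (measurable_of_finite _).aemeasurable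
          refine this.trans (by norm_num)
      _ = k * m / 4 := by
          simp
          ring
  have hcheb := meas_ge_le_variance_div_sq (μ := μ) (X := S) MemLp.of_discrete
    (c := 3 / 25 * (k * m)) (by positivity)
  have hcheb' : μ.real {Y | 3 / 25 * (k * m) ≤ |S Y - ∫ Y, S Y ∂μ|} ≤ 2 / 100 := by
    rw [measureReal_def]
    refine ENNReal.toReal_le_of_le_ofReal (by norm_num) (hcheb.trans (ENNReal.ofReal_le_ofReal ?_))
    have hk1 : (1 : ℝ) ≤ k := by exact_mod_cast NeZero.pos k
    rw [div_le_iff₀ (by positivity)]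
    refine hvar.trans ?_
    have : (1000 : ℝ) ≤ k * m := by nlinarith
    nlinarith
  set B : Set (Fin k × M × Fin m → Tok) := {Y | (rankOf V le_rfl ens x Y : ℝ) ≤ 4 * k / 5}
  have hB : meanRank T m V le_rfl ens (betaW k 0) x = μ.real B := by
    rw [meanRank, ← integral_indicator_one (Set.toFinite B).measurableSet]
    refine integral_congr_ae (Filter.Eventually.of_forall fun Y => ?_)
    by_cases hY : (rankOf V le_rfl ens x Y : ℝ) ≤ 4 * k / 5
    · simp [betaW, B, hY]
    · simp [betaW, B, hY]
  have hsub : Bᶜ ⊆ {Y | 3 / 25 * (k * m) ≤ |S Y - ∫ Y, S Y ∂μ|} := by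
    intro Y hY
    have hY' : 4 * k / 5 < (rankOf V le_rfl ens x Y : ℝ) := not_le.1 hY
    have hr : (rankOf V le_rfl ens x Y : ℝ) * (9 / 10 * m) ≤ S Y := by
      have hSY : S Y = ∑ r, ∑ i, hit m V x (r, ens r, i) Y := by
        simp only [S, e]
        rw [Fintype.sum_prod_type]
      rw [hSY, rankOf]
      push_cast
      rw [Finset.sum_mul]
      refine Finset.sum_le_sum fun r _ => ?_
      simp only [Fin.castLE_rfl, id]
      by_cases h9 : 9 / 10 ≤ accHat V x fun i => Y (r, ens r, i)
      · rw [if_pos h9, one_mul]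
        rwa [accHat_eq_sum_hit, le_div_iff₀ hm0] at h9
      · rw [if_neg h9, zero_mul]
        exact Finset.sum_nonneg fun i _ => by unfold hit; split_ifs <;> norm_num
    change 3 / 25 * (k * m) ≤ |S Y - ∫ Y, S Y ∂μ|
    refine le_trans ?_ (le_abs_self _)
    nlinarith
  have := probReal_compl_eq_one_sub (μ := μ) (Set.toFinite B).measurableSet
  have := measureReal_mono (μ := μ) hsub
  rw [hB]
  linarith

end

/-! ### The data set of one phase -/

section

instance : IsProbabilityMeasure unif01 :=
  ⟨by simp [unif01]⟩

theorem unif01_Iic {t : ℝ} (h1 : t ≤ 1) : unif01 {η | η ≤ t} = ENNReal.ofReal t := by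
  change unif01 (Set.Iic t) = _
  rw [unif01, Measure.restrict_apply measurableSet_Iic]
  have : Set.Iic t ∩ Set.Icc 0 1 = Set.Icc 0 t := by
    ext η
    simp only [Set.mem_inter_iff, Set.mem_Iic, Set.mem_Icc]
    constructor
    · rintro ⟨h, h', -⟩
      exact ⟨h', h⟩
    · rintro ⟨h, h'⟩
      exact ⟨h', h, h'.trans h1⟩
  rw [this, Real.volume_Icc, sub_zero]

variable {Tok : Type*} [MeasurableSpace Tok] [Fintype Tok] [DiscreteMeasurableSpace Tok]
  {X : Set (Str Tok)} {M : Finset (Model Tok)} {k T m : ℕ} [NeZero T] {V : X → Tok → Bool}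

theorem measurable_rankOf (hV : ∀ y, MeasurableSet {x | V x y = true}) {j : ℕ} (hj : j ≤ k)
    (ens : Fin j → M) :
    Measurable fun p : X × (Fin k × M × Fin m → Tok) => rankOf V hj ens p.1 p.2 := by
  refine measurable_from_prod_countable_left fun Y => ?_
  refine Finset.measurable_sum _ fun r _ => Measurable.ite ?_ measurable_const measurable_const
  refine measurableSet_le measurable_const (Measurable.div_const ?_ _)
  exact Finset.measurable_sum _ fun i _ => Measurable.ite (hV _) measurable_const measurable_const

theorem measurable_meanRank (hV : ∀ y, MeasurableSet {x | V x y = true}) {j : ℕ} (hj : j ≤ k)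
    (ens : Fin j → M) (f : ℕ → ℝ) : Measurable (meanRank T m V hj ens f) := by
  have h : Measurable fun p : X × (Fin k × M × Fin m → Tok) => f (rankOf V hj ens p.1 p.2) :=
    (measurable_of_countable f).comp (measurable_rankOf hV hj ens)
  exact (h.stronglyMeasurable.integral_kernel_prod_right'
    (κ := rolloutKernel M X T k m)).measurable

theorem measurable_passProb (hV : ∀ y, MeasurableSet {x | V x y = true}) (r : Fin k) (π : M) :
    Measurable (passProb T m V r π) := by
  have h : MeasurableSet {p : X × (Fin k × M × Fin m → Tok) |
      9 / 10 ≤ accHat V p.1 fun i => p.2 (r, π, i)} := by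
    refine measurableSet_le measurable_const (measurable_from_prod_countable_left fun Y => ?_)
    refine Measurable.div_const ?_ _
    exact Finset.measurable_sum _ fun i _ => Measurable.ite (hV _) measurable_const measurable_const
  exact (Kernel.measurable_kernel_prodMk_left (κ := rolloutKernel M X T k m) h).ennreal_toReal

theorem measurable_accReal (hV : ∀ y, MeasurableSet {x | V x y = true}) (π : Model Tok) :
    Measurable (accReal T V π) :=
  (measurable_accAt_outcome hV π).ennreal_toReal

theorem measurable_comp_rollouts {F : X × (Fin k × M × Fin m → Tok) → ℝ} (hF : Measurable F) :
    Measurable fun z : X × Tape M T k m => F (z.1, z.2.2.2) :=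
  hF.comp (by fun_prop)

theorem measurableSet_accept (hV : ∀ y, MeasurableSet {x | V x y = true}) {j : ℕ} (hj : j ≤ k)
    (ens : Fin j → M) (u : ℕ → ℝ) :
    MeasurableSet {z : X × Tape M T k m | z.2.1 ≤ u (rankHat V hj ens z)} := by
  have h1 : Measurable fun p : X × (Fin k × M × Fin m → Tok) => u (rankOf V hj ens p.1 p.2) :=
    (measurable_of_countable u).comp (measurable_rankOf hV hj ens)
  have h2 : Measurable fun z : X × Tape M T k m => z.2.1 := by fun_prop
  exact measurableSet_le h2 (measurable_comp_rollouts h1)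

/-- The law of a prompt and its chain of thought on the accepted region: the prompts are
reweighted by the conditional mean of the acceptance probability. -/
theorem setLIntegral_accept (hV : ∀ y, MeasurableSet {x | V x y = true}) (ρ : Measure X)
    [IsProbabilityMeasure ρ] (πstar : Model Tok) {j : ℕ} (hj : j ≤ k) (ens : Fin j → M) {u : ℕ → ℝ}
    (hu : ∀ s ≤ j, 0 ≤ u s ∧ u s ≤ 1) {g : X × (Fin T → Tok) → ℝ≥0∞} (hg : Measurable g) :
    ∫⁻ z in {z | z.2.1 ≤ u (rankHat V hj ens z)}, g (z.1, z.2.2.1)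
        ∂(promptLaw ρ πstar M T k m) =
      ∫⁻ x, ENNReal.ofReal (meanRank T m V hj ens u x) *
        ∫⁻ y, g (x, y) ∂(cotKernel πstar X T x) ∂ρ := by
  classical
  have hA := measurableSet_accept (T := T) (m := m) hV hj ens u
  have hg' : Measurable fun z : X × Tape M T k m => g (z.1, z.2.2.1) := by fun_prop
  rw [← lintegral_indicator hA, promptLaw, Measure.lintegral_compProd (hg'.indicator hA)]
  refine lintegral_congr fun x => ?_
  rw [Kernel.prod_apply, Kernel.prod_apply, Kernel.const_apply]
  refine (lintegral_prod_symm' _ ((hg'.indicator hA).comp measurable_prodMk_left)).trans ?_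
  simp only [Function.comp_apply]
  have h1 : ∀ c : (Fin T → Tok) × (Fin k × M × Fin m → Tok),
      ∫⁻ η, ({z : X × Tape M T k m | z.2.1 ≤ u (rankHat V hj ens z)}.indicator
        (fun z => g (z.1, z.2.2.1)) (x, η, c)) ∂unif01 =
      g (x, c.1) * ENNReal.ofReal (u (rankOf V hj ens x c.2)) := by
    intro c
    have h2 : ∀ η, ({z : X × Tape M T k m | z.2.1 ≤ u (rankHat V hj ens z)}.indicator
        (fun z => g (z.1, z.2.2.1)) (x, η, c)) =
        {η | η ≤ u (rankOf V hj ens x c.2)}.indicator (fun _ => g (x, c.1)) η := fun _ => rfl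
    have h1 := (hu _ (rankOf_le V hj ens x c.2)).2
    simp only [h2]
    rw [lintegral_indicator_const (s := {η : ℝ | η ≤ _}) measurableSet_Iic, unif01_Iic h1]
  simp only [h1]
  rw [lintegral_prod_mul (f := fun y => g (x, y)) (hg.comp measurable_prodMk_left).aemeasurable
    (g := fun Y => ENNReal.ofReal (u (rankOf V hj ens x Y)))
    (measurable_of_finite _).aemeasurable, mul_comm, meanRank,
    ofReal_integral_eq_lintegral_ofReal Integrable.of_finite
      (Filter.Eventually.of_forall fun Y => (hu _ (rankOf_le V hj ens x Y)).1)]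

end

/-! ### Failure probability of one phase -/

section

variable {Tok : Type*} [MeasurableSpace Tok] [Fintype Tok] [DiscreteMeasurableSpace Tok]
  {X : Set (Str Tok)} {M : Finset (Model Tok)} {k T m : ℕ} [NeZero T] {V : X → Tok → Bool}

instance (ρ : Measure X) [IsProbabilityMeasure ρ] (πstar : Model Tok) :
    IsProbabilityMeasure (promptLaw ρ πstar M T k m) := by
  unfold promptLaw; infer_instance

instance (ρ : Measure X) [IsProbabilityMeasure ρ] (πstar : Model Tok) (n : ℕ) :
    IsProbabilityMeasure (inputLaw ρ πstar M T k m n) := by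
  unfold inputLaw; infer_instance

theorem measurable_halfRatio (π π' : Model Tok) :
    Measurable fun p : X × (Fin T → Tok) => halfRatio π π' p.1 p.2 := by
  classical
  have h : ∀ (π : Model Tok) (y : Fin T → Tok), Measurable fun x : X => cot π x.1 T y :=
    fun π y => (measurable_cot π T y).comp measurable_subtype_coe
  refine measurable_from_prod_countable_left fun y => ?_
  exact Measurable.ite ((h π' y) (measurableSet_singleton 0)) measurable_const
    (((h π y).div (h π' y)).const_add 1 |>.div_const 2)

variable (T m) in
/-- The model `π` is inadequate for phase `j` with ensemble `ens`: the total weight of the prompts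
is not negligible, and the accuracy of `π` under the normalized weights is below `1 - 1/400`. -/
def FailsPhase (ρ : Measure X) (V : X → Tok → Bool) {j : ℕ} (hj : j ≤ k) (ens : Fin j → M)
    (τ : ℝ) (π : Model Tok) : Prop :=
  τ ≤ ∫ x, meanRank T m V hj ens (alphaW k j) x ∂ρ ∧
  ∫ x, meanRank T m V hj ens (alphaW k j) x * accReal T V π x ∂ρ <
    399 / 400 * ∫ x, meanRank T m V hj ens (alphaW k j) x ∂ρ

theorem integrable_of_mem_unitInterval {ρ : Measure X} [IsProbabilityMeasure ρ] {f : X → ℝ}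
    (hf : Measurable f) (h0 : ∀ x, 0 ≤ f x) (h1 : ∀ x, f x ≤ 1) : Integrable f ρ :=
  Integrable.of_bound hf.aestronglyMeasurable 1
    (Filter.Eventually.of_forall fun x => by
      rw [Real.norm_eq_abs, abs_le]
      constructor <;> linarith [h0 x, h1 x])

theorem integrable_meanRank (ρ : Measure X) [IsProbabilityMeasure ρ]
    (hV : ∀ y, MeasurableSet {x | V x y = true}) {j : ℕ} (hj : j ≤ k) (ens : Fin j → M)
    {f : ℕ → ℝ} (hf0 : ∀ s, 0 ≤ f s) (hf1 : ∀ s, f s ≤ 1) :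
    Integrable (meanRank T m V hj ens f) ρ :=
  integrable_of_mem_unitInterval (measurable_meanRank hV hj ens f)
    (meanRank_nonneg T m V hj ens hf0) (meanRank_le_one T m V hj ens hf1)

theorem integrable_meanRank_mul (ρ : Measure X) [IsProbabilityMeasure ρ]
    (hV : ∀ y, MeasurableSet {x | V x y = true}) {j : ℕ} (hj : j ≤ k) (ens : Fin j → M)
    {f : ℕ → ℝ} (hf0 : ∀ s, 0 ≤ f s) (hf1 : ∀ s, f s ≤ 1) {g : X → ℝ} (hg : Measurable g)
    (h0 : ∀ x, 0 ≤ g x) (h1 : ∀ x, g x ≤ 1) :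
    Integrable (fun x => meanRank T m V hj ens f x * g x) ρ :=
  integrable_of_mem_unitInterval ((measurable_meanRank hV hj ens f).mul hg)
    (fun x => mul_nonneg (meanRank_nonneg T m V hj ens hf0 x) (h0 x))
    (fun x => mul_le_one₀ (meanRank_le_one T m V hj ens hf1 x) (h0 x) (h1 x))

/-- For a model that fails phase `j`, the product of the weights `halfRatio` over the data of the
phase has small mean. -/
theorem lintegral_prod_halfRatio_le (hV : ∀ y, MeasurableSet {x | V x y = true}) (ρ : Measure X)
    [IsProbabilityMeasure ρ] {πstar : Model Tok} (hstar : acc ρ V (fun x => outcome πstar T x.1) = 1)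
    {j : ℕ} (hj : j ≤ k) (ens : Fin j → M) {τ : ℝ} (hτ : 0 < τ) {π : Model Tok}
    (hπ : FailsPhase T m ρ V hj ens τ π) (L N : ℕ) :
    ∫⁻ ω, ((sample (fun z : X × Tape M T k m =>
        z.2.1 ≤ alphaW k j (rankHat V hj ens z) / alphaMax k j) N [] (List.ofFn ω)).map
          fun z => halfRatio π πstar z.1 z.2.2.1).prod
        ∂(Measure.pi fun _ : Fin L => promptLaw ρ πstar M T k m) ≤
      ENNReal.ofReal (799 / 800) ^ N + ENNReal.ofReal (1 - τ / 800) ^ L := by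
  set u : ℕ → ℝ := fun s => alphaW k j s / alphaMax k j with hu_def
  set α := meanRank T m V hj ens (alphaW k j) with hα
  set A : Set (X × Tape M T k m) := {z | z.2.1 ≤ u (rankHat V hj ens z)} with hA_def
  set μ := promptLaw ρ πstar M T k m
  have hA : MeasurableSet A := measurableSet_accept hV hj ens u
  have hu : ∀ s ≤ j, 0 ≤ u s ∧ u s ≤ 1 := fun s hs =>
    ⟨div_nonneg (alphaW_nonneg k j s) (alphaMax_nonneg k j),
      div_le_one_of_le₀ (alphaW_le_alphaMax hs) (alphaMax_nonneg k j)⟩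
  have hαi : Integrable α ρ :=
    integrable_meanRank ρ hV hj ens (alphaW_nonneg k j) (alphaW_le_one k j)
  have hαacc : Integrable (fun x => α x * accReal T V π x) ρ :=
    integrable_meanRank_mul ρ hV hj ens (alphaW_nonneg k j) (alphaW_le_one k j)
      (measurable_accReal hV π) (accReal_nonneg T V π) (accReal_le_one T V π)
  have hα0 : ∀ x, 0 ≤ α x := meanRank_nonneg T m V hj ens (alphaW_nonneg k j)
  -- The maximal weight is positive because the mean weight is.
  have hmax : 0 < alphaMax k j := by
    have h1 : ∫ x, α x ∂ρ ≤ ∫ _, alphaMax k j ∂ρ := by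
      refine integral_mono hαi (integrable_const _) fun x => ?_
      calc α x ≤ ∫ _, alphaMax k j ∂(rolloutKernel M X T k m x) :=
            integral_mono Integrable.of_finite (integrable_const _) fun Y =>
              alphaW_le_alphaMax (rankOf_le V hj ens x Y)
        _ = alphaMax k j := by simp
    rw [integral_const, probReal_univ, one_smul] at h1
    exact hτ.trans_le (hπ.1.trans h1)
  have hu_mean : ∀ x, meanRank T m V hj ens u x = (alphaMax k j)⁻¹ * α x := by
    intro x
    have : u = fun s => (alphaMax k j)⁻¹ * alphaW k j s := by
      funext s; rw [hu_def]; exact div_eq_inv_mul _ _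
    rw [this, meanRank_const_mul]
  set a : ℝ := (alphaMax k j)⁻¹ * ∫ x, α x ∂ρ with ha_def
  have hinv : 1 ≤ (alphaMax k j)⁻¹ := (one_le_inv₀ hmax).2 (alphaMax_le_one k j)
  have ha : τ ≤ a := by
    have := hπ.1
    change τ ≤ ∫ x, α x ∂ρ at this
    nlinarith
  have hμA : μ A = ENNReal.ofReal a := by
    have := setLIntegral_accept (T := T) (m := m) hV ρ πstar hj ens hu
      (g := fun _ => 1) measurable_const
    simp only [lintegral_const, Measure.restrict_apply_univ, measure_univ, mul_one, one_mul] at this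
    refine this.trans ?_
    simp only [hu_mean]
    rw [ha_def, ← integral_const_mul, ofReal_integral_eq_lintegral_ofReal (hαi.const_mul _)
      (Filter.Eventually.of_forall fun x => mul_nonneg (by positivity) (hα0 x))]
  have ha1 : a ≤ 1 := by
    have : μ A ≤ 1 := prob_le_one
    rw [hμA] at this
    exact ENNReal.ofReal_le_one.1 this
  have hR : Measurable fun z : X × Tape M T k m => halfRatio π πstar z.1 z.2.2.1 :=
    (measurable_halfRatio π πstar).comp (f := fun z : X × Tape M T k m => (z.1, z.2.2.1))
      (by fun_prop)
  have hRA : ∫⁻ z in A, halfRatio π πstar z.1 z.2.2.1 ∂μ ≤ ENNReal.ofReal (799 / 800) * μ A := by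
    have := setLIntegral_accept (T := T) (m := m) hV ρ πstar hj ens hu
      (measurable_halfRatio π πstar)
    refine this.le.trans ?_
    calc ∫⁻ x, ENNReal.ofReal (meanRank T m V hj ens u x) *
          ∫⁻ y, halfRatio π πstar x y ∂(cotKernel πstar X T x) ∂ρ
        ≤ ∫⁻ x, ENNReal.ofReal
            ((alphaMax k j)⁻¹ * (1 / 2) * (α x + α x * accReal T V π x)) ∂ρ := by
          refine lintegral_mono_ae ?_
          filter_upwards [ae_accAt_eq_one πstar hstar] with x hx
          have h1 : (1 + accAt V (fun x => outcome π T x.1) x) / 2 =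
              ENNReal.ofReal ((1 + accReal T V π x) / 2) := by
            rw [ENNReal.ofReal_div_of_pos two_pos, ENNReal.ofReal_add zero_le_one
              (accReal_nonneg T V π x), accReal, ENNReal.ofReal_toReal (accAt_ne_top V _ x)]
            simp
          refine (mul_le_mul' le_rfl (lintegral_halfRatio_le V π πstar x hx)).trans ?_
          rw [h1, hu_mean, ← ENNReal.ofReal_mul (mul_nonneg (by positivity) (hα0 x))]
          exact ENNReal.ofReal_le_ofReal (le_of_eq (by ring))
      _ = ENNReal.ofReal ((alphaMax k j)⁻¹ * (1 / 2) *
            (∫ x, α x ∂ρ + ∫ x, α x * accReal T V π x ∂ρ)) := by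
          rw [← integral_add hαi hαacc, ← integral_const_mul]
          refine (ofReal_integral_eq_lintegral_ofReal ((hαi.add hαacc).const_mul _)
            (Filter.Eventually.of_forall fun x => ?_)).symm
          have := hα0 x
          have := accReal_nonneg T V π x
          change 0 ≤ (alphaMax k j)⁻¹ * (1 / 2) * (α x + α x * accReal T V π x)
          positivity
      _ ≤ ENNReal.ofReal (799 / 800) * μ A := by
          rw [hμA, ← ENNReal.ofReal_mul (by norm_num)]
          refine ENNReal.ofReal_le_ofReal ?_
          have := hπ.2.le
          change ∫ x, α x * accReal T V π x ∂ρ ≤ 399 / 400 * ∫ x, α x ∂ρ at this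
          calc (alphaMax k j)⁻¹ * (1 / 2) * (∫ x, α x ∂ρ + ∫ x, α x * accReal T V π x ∂ρ)
              ≤ (alphaMax k j)⁻¹ * (1 / 2) * (∫ x, α x ∂ρ + 399 / 400 * ∫ x, α x ∂ρ) := by
                gcongr
            _ = 799 / 800 * a := by rw [ha_def]; ring
  refine (lintegral_prod_sample_le μ hA hR hRA L N).trans ?_
  gcongr
  change μ Aᶜ + _ * μ A ≤ _
  rw [prob_compl_eq_one_sub hA, hμA, ← ENNReal.ofReal_one,
    ← ENNReal.ofReal_sub _ (hτ.le.trans ha), ← ENNReal.ofReal_mul (by norm_num),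
    ← ENNReal.ofReal_add (by linarith) (by linarith)]
  exact ENNReal.ofReal_le_ofReal (by linarith)

end

/-! ### Failure probability of the algorithm -/

section

section SampleMeasurability

variable {Z : Type*} [MeasurableSpace Z] {accept : Z → Prop}

/-- A measurable property of lists is a measurable property of the kept sublist; `w` holds what has
been kept so far. -/
theorem measurableSet_sample_append (hA : MeasurableSet {z | accept z}) (F : List Z → Prop)
    (hF : ∀ n, MeasurableSet {D : Fin n → Z | F (List.ofFn D)}) (N L p : ℕ) :
    MeasurableSet {q : (Fin p → Z) × (Fin L → Z) |
      F (sample accept N (List.ofFn q.1) (List.ofFn q.2))} := by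
  classical
  induction L generalizing p with
  | zero =>
    simp only [List.ofFn_zero, sample]
    exact measurable_fst (hF p)
  | succ L ih =>
    by_cases hN : N ≤ p
    · simp only [List.ofFn_succ (n := L), sample, List.length_ofFn, hN, if_true]
      exact measurable_fst (hF p)
    · have hB : MeasurableSet {q : (Fin p → Z) × (Fin (L + 1) → Z) | accept (q.2 0)} :=
        ((measurable_pi_apply 0).comp measurable_snd) hA
      have h1 : MeasurableSet {q : (Fin p → Z) × (Fin (L + 1) → Z) |
          F (sample accept N (List.ofFn q.1 ++ [q.2 0]) (List.ofFn fun i => q.2 (Fin.succ i)))} := by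
        have hmap : Measurable fun q : (Fin p → Z) × (Fin (L + 1) → Z) =>
            ((Fin.snoc (α := fun _ => Z) q.1 (q.2 0) : Fin (p + 1) → Z),
              fun i : Fin L => q.2 i.succ) := by
          refine Measurable.prodMk (measurable_pi_lambda _ fun i => ?_) (by fun_prop)
          induction i using Fin.lastCases with
          | last => simp only [Fin.snoc_last]; fun_prop
          | cast i => simp only [Fin.snoc_castSucc]; fun_prop
        have := hmap (ih (p + 1))
        have hsnoc : ∀ q : (Fin p → Z) × (Fin (L + 1) → Z),
            List.ofFn (Fin.snoc (α := fun _ => Z) q.1 (q.2 0) : Fin (p + 1) → Z) =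
              List.ofFn q.1 ++ [q.2 0] := by
          intro q
          rw [List.ofFn_succ', List.concat_eq_append]
          simp
        simpa only [Set.preimage_ofPred_eq, hsnoc] using this
      have h2 : MeasurableSet {q : (Fin p → Z) × (Fin (L + 1) → Z) |
          F (sample accept N (List.ofFn q.1) (List.ofFn fun i => q.2 (Fin.succ i)))} := by
        have hmap : Measurable fun q : (Fin p → Z) × (Fin (L + 1) → Z) =>
            (q.1, fun i : Fin L => q.2 i.succ) := by fun_prop
        exact hmap (ih p)
      have := (hB.inter h1).union (hB.compl.inter h2)
      convert this using 1
      ext q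
      simp only [List.ofFn_succ (n := L), sample, List.length_ofFn, hN, if_false, Set.mem_union,
        Set.mem_inter_iff, Set.mem_compl_iff, Set.mem_ofPred_eq]
      by_cases hq : accept (q.2 0) <;> simp [hq]

theorem measurableSet_sample (hA : MeasurableSet {z | accept z}) (F : List Z → Prop)
    (hF : ∀ n, MeasurableSet {D : Fin n → Z | F (List.ofFn D)}) (N L : ℕ) :
    MeasurableSet {ω : Fin L → Z | F (sample accept N [] (List.ofFn ω))} :=
  (measurable_prodMk_left (x := (Fin.elim0 : Fin 0 → Z)))
    (measurableSet_sample_append hA F hF N L 0)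

end SampleMeasurability

theorem take_drop_ofFn {Z : Type*} {n : ℕ} (ω : Fin n → Z) {a L : ℕ} (h : a + L ≤ n) :
    ((List.ofFn ω).drop a).take L = List.ofFn fun i : Fin L => ω ⟨a + i, by omega⟩ := by
  apply List.ext_getElem
  · simp; omega
  · intro i h1 h2
    simp

theorem block_le {k n j : ℕ} (hj : j + 1 ≤ k) : j * (n / k) + n / k ≤ n :=
  calc j * (n / k) + n / k = (j + 1) * (n / k) := by ring
    _ ≤ k * (n / k) := Nat.mul_le_mul_right _ hj
    _ ≤ n := Nat.mul_div_le n k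

/-- The prompts of phase `j`. -/
def block {Z : Type*} {k n j : ℕ} (hj : j + 1 ≤ k) (ω : Fin n → Z) : Fin (n / k) → Z :=
  fun i => ω ⟨j * (n / k) + i, by have := block_le (n := n) hj; omega⟩

variable {Tok : Type*} [MeasurableSpace Tok] [Fintype Tok]
  {X : Set (Str Tok)} {M : Finset (Model Tok)} {k T m : ℕ}

/-- The model trained in phase `j` from the ensemble `ens` and the prompts `l`. -/
noncomputable def trainModel (V : X → Tok → Bool) (erm : ERMOracle M X T) (N : ℕ) {j : ℕ}
    (hj : j ≤ k) (ens : Fin j → M) (l : List (X × Tape M T k m)) : M :=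
  let out := sample (fun z => z.2.1 ≤ alphaW k j (rankHat V hj ens z) / alphaMax k j) N [] l
  erm.fit out.length fun i => ((out.get i).1, (out.get i).2.2.1)

theorem run_succ_ens (V : X → Tok → Bool) (erm : ERMOracle M X T) (N : ℕ) {n : ℕ}
    (ω : Fin n → X × Tape M T k m) {j : ℕ} (hj : j + 1 ≤ k) :
    (run V erm N ω (j + 1) hj).ens = Fin.snoc (α := fun _ => M)
      (run V erm N ω j (Nat.le_of_succ_le hj)).ens
      (trainModel V erm N (Nat.le_of_succ_le hj) (run V erm N ω j (Nat.le_of_succ_le hj)).ens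
        (List.ofFn (block hj ω))) := by
  have h := take_drop_ofFn ω (block_le (n := n) hj)
  simp only [run, phase, trainModel]
  rw [h]
  rfl

theorem run_ens_castLE (V : X → Tok → Bool) (erm : ERMOracle M X T) (N : ℕ) {n : ℕ}
    (ω : Fin n → X × Tape M T k m) {i j : ℕ} (hij : i ≤ j) (hj : j ≤ k) (r : Fin i) :
    (run V erm N ω j hj).ens (Fin.castLE hij r) = (run V erm N ω i (hij.trans hj)).ens r := by
  induction j with
  | zero =>
    obtain rfl : i = 0 := Nat.le_zero.1 hij
    exact r.elim0
  | succ j ih =>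
    rcases Nat.lt_or_ge j i with h | h
    · obtain rfl : i = j + 1 := by omega
      rfl
    · rw [run_succ_ens, ← ih h (Nat.le_of_succ_le hj)]
      exact Fin.snoc_castSucc (α := fun _ => M) _ _ (Fin.castLE h r)

/-- The ensemble before phase `j` only depends on the prompts of the earlier phases. -/
theorem run_ens_congr (V : X → Tok → Bool) (erm : ERMOracle M X T) (N : ℕ) {n : ℕ}
    {ω ω' : Fin n → X × Tape M T k m} {j : ℕ} (hj : j ≤ k)
    (h : ∀ i : Fin n, i.1 < j * (n / k) → ω i = ω' i) :
    (run V erm N ω j hj).ens = (run V erm N ω' j hj).ens := by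
  induction j with
  | zero => rfl
  | succ j ih =>
    have hmul : (j + 1) * (n / k) = j * (n / k) + n / k := by ring
    have h1 := ih (Nat.le_of_succ_le hj) fun i hi =>
      h i (hi.trans_le (Nat.mul_le_mul_right _ (Nat.le_succ j)))
    have h2 : block hj ω = block hj ω' := by
      funext i
      exact h _ (by have := i.2; simp only; omega)
    rw [run_succ_ens, run_succ_ens, h1, h2]

theorem fit_get_ofFn {Z : Type*} (erm : ERMOracle M X T) (φ : Z → X × (Fin T → Tok)) {n : ℕ}
    (D : Fin n → Z) :
    erm.fit (List.ofFn D).length (fun i => φ ((List.ofFn D).get i)) =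
      erm.fit n fun i => φ (D i) := by
  have h : ∀ (n' : ℕ) (hn : n' = n) (D' : Fin n' → Z), (∀ i, D' i = D (i.cast hn)) →
      erm.fit n' (fun i => φ (D' i)) = erm.fit n fun i => φ (D i) := by
    rintro n' rfl D' hD'
    congr 1
    funext i
    rw [hD']
    rfl
  exact h _ List.length_ofFn _ fun i => by
    simp only [List.get_eq_getElem, List.getElem_ofFn]
    rfl

variable [DiscreteMeasurableSpace Tok] [NeZero T] {V : X → Tok → Bool}

theorem measurableSet_trainModel_eq (hV : ∀ y, MeasurableSet {x | V x y = true})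
    (erm : ERMOracle M X T) (N L : ℕ) {j : ℕ} (hj : j ≤ k) (ens : Fin j → M) (π : M) :
    MeasurableSet {ω : Fin L → X × Tape M T k m |
      trainModel V erm N hj ens (List.ofFn ω) = π} := by
  refine measurableSet_sample (Z := X × Tape M T k m)
    (measurableSet_accept hV hj ens fun s => alphaW k j s / alphaMax k j)
    (fun l => erm.fit l.length (fun i => ((l.get i).1, (l.get i).2.2.1)) = π) (fun n => ?_) N L
  have h : ∀ D : Fin n → X × Tape M T k m, erm.fit (List.ofFn D).length
      (fun i => (((List.ofFn D).get i).1, ((List.ofFn D).get i).2.2.1)) =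
      erm.fit n fun i => ((D i).1, (D i).2.2.1) :=
    fun D => fit_get_ofFn erm (fun z : X × Tape M T k m => (z.1, z.2.2.1)) D
  simp only [h]
  have hm : Measurable fun (D : Fin n → X × Tape M T k m) (i : Fin n) =>
      ((D i).1, (D i).2.2.1) := by fun_prop
  exact hm (erm.measurableSet_fit n π)

/-- A log-loss minimizer is at least as likely on the data as the teacher, so that the weights
`halfRatio` multiply to at least one. -/
theorem one_le_prod_of_trainModel_eq {πstar : Model Tok} (hM : πstar ∈ M) (erm : ERMOracle M X T)
    (N : ℕ) {j : ℕ} (hj : j ≤ k) (ens : Fin j → M) (l : List (X × Tape M T k m)) :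
    1 ≤ ((sample (fun z => z.2.1 ≤ alphaW k j (rankHat V hj ens z) / alphaMax k j) N [] l).map
      fun z => halfRatio (trainModel V erm N hj ens l).1 πstar z.1 z.2.2.1).prod := by
  set out := sample (fun z => z.2.1 ≤ alphaW k j (rankHat V hj ens z) / alphaMax k j) N [] l
  have h := one_le_prod_halfRatio (prod_cot_le_of_empLogLoss_le (erm.fit_le out.length
    (fun i => ((out.get i).1, (out.get i).2.2.1)) πstar hM))
  rw [← Fin.prod_univ_fun_getElem]
  exact h

theorem inputLaw_block_trainModel_eq_le (hV : ∀ y, MeasurableSet {x | V x y = true})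
    (ρ : Measure X) [IsProbabilityMeasure ρ] {πstar : Model Tok} (hM : πstar ∈ M)
    (hstar : acc ρ V (fun x => outcome πstar T x.1) = 1) (erm : ERMOracle M X T) (N n : ℕ) {j : ℕ}
    (hj : j + 1 ≤ k) (ens : Fin j → M) {τ : ℝ} (hτ : 0 < τ) {π : M}
    (hπ : FailsPhase T m ρ V (Nat.le_of_succ_le hj) ens τ π.1) :
    inputLaw ρ πstar M T k m n {ω | trainModel V erm N (Nat.le_of_succ_le hj) ens
        (List.ofFn (block hj ω)) = π} ≤
      ENNReal.ofReal (799 / 800) ^ N + ENNReal.ofReal (1 - τ / 800) ^ (n / k) := by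
  have hinj : Function.Injective fun i : Fin (n / k) =>
      (⟨j * (n / k) + i, by have := block_le (n := n) hj; omega⟩ : Fin n) := by
    intro a b hab
    simp only [Fin.mk.injEq] at hab
    exact Fin.ext (by omega)
  have hmp := measurePreserving_pi_comp (promptLaw ρ πstar M T k m) hinj
  have hms := measurableSet_trainModel_eq (m := m) hV erm N (n / k) (Nat.le_of_succ_le hj) ens π
  have h1 := hmp.measure_preimage hms.nullMeasurableSet
  refine h1.le.trans (le_trans ?_ (lintegral_prod_halfRatio_le hV ρ hstar _ ens hτ hπ (n / k) N))
  have hmeas := measurable_prod_sample (Z := X × Tape M T k m)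
    (measurableSet_accept hV (Nat.le_of_succ_le hj) ens fun s => alphaW k j s / alphaMax k j)
    (R := fun z => halfRatio π.1 πstar z.1 z.2.2.1)
    ((measurable_halfRatio π.1 πstar).comp (f := fun z : X × Tape M T k m => (z.1, z.2.2.1))
      (by fun_prop)) (n / k) N
  have h2 := mul_meas_ge_le_lintegral (μ := Measure.pi fun _ => promptLaw ρ πstar M T k m) hmeas 1
  rw [one_mul] at h2
  refine le_trans (measure_mono ?_) h2
  rintro ω rfl
  exact one_le_prod_of_trainModel_eq hM erm N _ ens _

theorem measurableSet_run_ens_eq (hV : ∀ y, MeasurableSet {x | V x y = true})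
    (erm : ERMOracle M X T) (N n : ℕ) {j : ℕ} (hj : j ≤ k) (ens : Fin j → M) :
    MeasurableSet {ω : Fin n → X × Tape M T k m | (run V erm N ω j hj).ens = ens} := by
  induction j with
  | zero =>
    have : {ω : Fin n → X × Tape M T k m | (run V erm N ω 0 hj).ens = ens} = Set.univ :=
      Set.eq_univ_of_forall fun ω => Subsingleton.elim (α := Fin 0 → M) _ _
    rw [this]
    exact MeasurableSet.univ
  | succ j ih =>
    have hblock : Measurable fun ω : Fin n → X × Tape M T k m => block hj ω :=
      measurable_pi_lambda _ fun i => measurable_pi_apply _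
    have h1 := (ih (Nat.le_of_succ_le hj) (Fin.init ens)).inter
      (hblock (measurableSet_trainModel_eq hV erm N (n / k) (Nat.le_of_succ_le hj) (Fin.init ens)
        (ens (Fin.last j))))
    convert h1 using 1
    ext ω
    simp only [Set.mem_inter_iff, Set.mem_ofPred_eq, Set.mem_preimage]
    rw [run_succ_ens]
    constructor
    · rintro h
      have h' : Fin.init ens = (run V erm N ω j (Nat.le_of_succ_le hj)).ens := by
        rw [← h, Fin.init_snoc]
      rw [h']
      exact ⟨rfl, by rw [← h, Fin.snoc_last]⟩
    · rintro ⟨h, h'⟩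
      rw [h, h']
      exact Fin.snoc_init_self ens

/-- Given the ensemble, the prompts of the next phase are fresh, so that a union bound over the
models of the class applies. -/
theorem inputLaw_failsPhase_le (hV : ∀ y, MeasurableSet {x | V x y = true})
    (ρ : Measure X) [IsProbabilityMeasure ρ] {πstar : Model Tok} (hM : πstar ∈ M)
    (hstar : acc ρ V (fun x => outcome πstar T x.1) = 1) (erm : ERMOracle M X T) (N n : ℕ) {j : ℕ}
    (hj : j + 1 ≤ k) {τ : ℝ} (hτ : 0 < τ) :
    inputLaw ρ πstar M T k m n {ω | FailsPhase T m ρ V (Nat.le_of_succ_le hj)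
        (run V erm N ω j (Nat.le_of_succ_le hj)).ens τ
        ((run V erm N ω (j + 1) hj).ens (Fin.last j)).1} ≤
      M.card * (ENNReal.ofReal (799 / 800) ^ N + ENNReal.ofReal (1 - τ / 800) ^ (n / k)) := by
  classical
  set γ := ENNReal.ofReal (799 / 800) ^ N + ENNReal.ofReal (1 - τ / 800) ^ (n / k)
  set hj' := Nat.le_of_succ_le hj
  set μ := inputLaw ρ πstar M T k m n with hμ
  set A : (Fin j → M) → Set (Fin n → X × Tape M T k m) :=
    fun e => {ω | (run V erm N ω j hj').ens = e}
  set B : (Fin j → M) → M → Set (Fin n → X × Tape M T k m) :=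
    fun e π => {ω | trainModel V erm N hj' e (List.ofFn (block hj ω)) = π ∧
      FailsPhase T m ρ V hj' e τ π.1}
  have hB : ∀ e π, μ (A e ∩ B e π) ≤ μ (A e) * γ := by
    intro e π
    by_cases hf : FailsPhase T m ρ V hj' e τ π.1
    · have hBe : B e π = {ω | trainModel V erm N hj' e (List.ofFn (block hj ω)) = π} := by
        ext ω
        simp [B, hf]
      rw [hBe]
      refine le_trans (le_of_eq ?_) (mul_le_mul' le_rfl
        (inputLaw_block_trainModel_eq_le hV ρ hM hstar erm N n hj e hτ hf))
      refine measure_pi_inter_of_dependsOn _ (fun i : Fin n => i.1 < j * (n / k)) ?_ ?_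
      · intro ω ω' h
        simp only [A, Set.mem_ofPred_eq]
        rw [run_ens_congr V erm N hj' h]
      · intro ω ω' h
        have : block hj ω = block hj ω' := by
          funext i
          exact h _ (by simp)
        simp only [Set.mem_ofPred_eq, this]
    · have hBe : B e π = ∅ := by
        ext ω
        simp [B, hf]
      simp [hBe]
  have hsub : {ω | FailsPhase T m ρ V hj' (run V erm N ω j hj').ens τ
      ((run V erm N ω (j + 1) hj).ens (Fin.last j)).1} ⊆ ⋃ e, ⋃ π, A e ∩ B e π := by
    intro ω hω
    simp only [Set.mem_iUnion]
    refine ⟨_, _, rfl, rfl, ?_⟩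
    have hω' : FailsPhase T m ρ V hj' (run V erm N ω j hj').ens τ
      ((run V erm N ω (j + 1) hj).ens (Fin.last j)).1 := hω
    rwa [run_succ_ens, Fin.snoc_last] at hω'
  have hsum : ∑ e, μ (A e) = 1 := by
    have := sum_measure_preimage_singleton (μ := μ) (Finset.univ : Finset (Fin j → M))
      (f := fun ω => (run V erm N ω j hj').ens)
      (fun e _ => measurableSet_run_ens_eq hV erm N n hj' e)
    rw [Finset.coe_univ, Set.preimage_univ, measure_univ] at this
    exact this
  calc _ ≤ μ (⋃ e, ⋃ π, A e ∩ B e π) := measure_mono hsub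
    _ ≤ ∑ e, ∑ π, μ (A e ∩ B e π) :=
        (measure_iUnion_fintype_le _ _).trans
          (Finset.sum_le_sum fun e _ => measure_iUnion_fintype_le _ _)
    _ ≤ ∑ e, ∑ _π : M, μ (A e) * γ :=
        Finset.sum_le_sum fun e _ => Finset.sum_le_sum fun π _ => hB e π
    _ = M.card * γ := by
        simp only [Finset.sum_const, Finset.card_univ, Fintype.card_coe, nsmul_eq_mul]
        rw [← Finset.mul_sum, ← Finset.sum_mul, hsum, one_mul]

/-- With high probability, no phase fails. -/
theorem inputLaw_exists_failsPhase_le (hV : ∀ y, MeasurableSet {x | V x y = true})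
    (ρ : Measure X) [IsProbabilityMeasure ρ] {πstar : Model Tok} (hM : πstar ∈ M)
    (hstar : acc ρ V (fun x => outcome πstar T x.1) = 1) (erm : ERMOracle M X T) (N n : ℕ)
    {τ : ℝ} (hτ : 0 < τ) :
    inputLaw ρ πstar M T k m n {ω | ∃ (j : ℕ) (hj : j + 1 ≤ k),
        FailsPhase T m ρ V (Nat.le_of_succ_le hj)
          (fun r => (run V erm N ω k le_rfl).ens (Fin.castLE (Nat.le_of_succ_le hj) r)) τ
          ((run V erm N ω k le_rfl).ens ⟨j, hj⟩).1} ≤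
      k * (M.card * (ENNReal.ofReal (799 / 800) ^ N + ENNReal.ofReal (1 - τ / 800) ^ (n / k))) := by
  set γ := M.card * (ENNReal.ofReal (799 / 800) ^ N + ENNReal.ofReal (1 - τ / 800) ^ (n / k))
  set E : Fin k → Set (Fin n → X × Tape M T k m) := fun j =>
    {ω | FailsPhase T m ρ V (Nat.le_of_succ_le j.2)
        (run V erm N ω j (Nat.le_of_succ_le j.2)).ens τ
        ((run V erm N ω (j + 1) j.2).ens (Fin.last j)).1}
  calc _ ≤ inputLaw ρ πstar M T k m n (⋃ j, E j) := by
        refine measure_mono ?_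
        rintro ω ⟨j, hj, h⟩
        refine Set.mem_iUnion.2 ⟨⟨j, hj⟩, ?_⟩
        have h1 : (fun r => (run V erm N ω k le_rfl).ens (Fin.castLE (Nat.le_of_succ_le hj) r)) =
            (run V erm N ω j (Nat.le_of_succ_le hj)).ens :=
          funext fun r => run_ens_castLE V erm N ω _ le_rfl r
        have h2 : (run V erm N ω k le_rfl).ens ⟨j, hj⟩ =
            (run V erm N ω (j + 1) hj).ens (Fin.last j) :=
          run_ens_castLE V erm N ω hj le_rfl (Fin.last j)
        rw [h1, h2] at h
        exact h
    _ ≤ ∑ j, inputLaw ρ πstar M T k m n (E j) := measure_iUnion_fintype_le _ _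
    _ ≤ ∑ _j : Fin k, γ := Finset.sum_le_sum fun j _ =>
        inputLaw_failsPhase_le hV ρ hM hstar erm N n j.2 hτ
    _ = k * γ := by simp

end

/-! ### The boosting argument -/

section

variable {Tok : Type*} [MeasurableSpace Tok] [Fintype Tok] [DiscreteMeasurableSpace Tok]
  {X : Set (Str Tok)} {M : Finset (Model Tok)} {k T m : ℕ} [NeZero T] {V : X → Tok → Bool}

/-- A phase that does not fail increases the potential by at most `τ`: either the total weight is
below `τ`, or the weighted probability of passing the test is at least `1 - 10/400 ≥ 9/10`. -/
theorem integral_drift_le (hV : ∀ y, MeasurableSet {x | V x y = true}) (ρ : Measure X)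
    [IsProbabilityMeasure ρ] (hm : 0 < m) {j : ℕ} (hj : j + 1 ≤ k) (ens : Fin j → M) (π : M)
    {τ : ℝ} (hτ : 0 < τ) (h : ¬ FailsPhase T m ρ V (Nat.le_of_succ_le hj) ens τ π.1) :
    ∫ x, (9 / 10 - passProb T m V ⟨j, hj⟩ π x) *
      meanRank T m V (Nat.le_of_succ_le hj) ens (alphaW k j) x ∂ρ ≤ τ := by
  set α := meanRank T m V (Nat.le_of_succ_le hj) ens (alphaW k j)
  set p := passProb T m V ⟨j, hj⟩ π
  have hαi : Integrable α ρ :=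
    integrable_meanRank ρ hV _ ens (alphaW_nonneg k j) (alphaW_le_one k j)
  have hαp : Integrable (fun x => α x * p x) ρ :=
    integrable_meanRank_mul ρ hV _ ens (alphaW_nonneg k j) (alphaW_le_one k j)
      (measurable_passProb hV _ π) (passProb_nonneg T m V _ π) (passProb_le_one T m V _ π)
  have hαacc : Integrable (fun x => α x * accReal T V π.1 x) ρ :=
    integrable_meanRank_mul ρ hV _ ens (alphaW_nonneg k j) (alphaW_le_one k j)
      (measurable_accReal hV π.1) (accReal_nonneg T V π.1) (accReal_le_one T V π.1)
  have hα0 : ∀ x, 0 ≤ α x := meanRank_nonneg T m V _ ens (alphaW_nonneg k j)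
  have hLi : Integrable (fun x => (9 / 10 - p x) * α x) ρ := by
    have : (fun x => (9 / 10 - p x) * α x) = fun x => 9 / 10 * α x - α x * p x := by
      funext x; ring
    rw [this]
    exact (hαi.const_mul _).sub hαp
  by_cases hsmall : ∫ x, α x ∂ρ < τ
  · refine (integral_mono hLi hαi fun x => ?_).trans hsmall.le
    have h1 := passProb_nonneg T m V ⟨j, hj⟩ π x
    have h2 := hα0 x
    change (9 / 10 - p x) * α x ≤ α x
    have : 0 ≤ p x := h1
    nlinarith
  · have hacc : 399 / 400 * ∫ x, α x ∂ρ ≤ ∫ x, α x * accReal T V π.1 x ∂ρ := by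
      by_contra hlt
      exact h ⟨not_lt.1 hsmall, not_le.1 hlt⟩
    calc ∫ x, (9 / 10 - p x) * α x ∂ρ
        ≤ ∫ x, (99 / 10 * α x - 10 * (α x * accReal T V π.1 x)) ∂ρ := by
          refine integral_mono hLi ((hαi.const_mul _).sub (hαacc.const_mul _)) fun x => ?_
          have h1 : 1 - p x ≤ 10 * (1 - accReal T V π.1 x) :=
            one_sub_passProb_le T m V hm ⟨j, hj⟩ π x
          have h2 := hα0 x
          change (9 / 10 - p x) * α x ≤ 99 / 10 * α x - 10 * (α x * accReal T V π.1 x)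
          nlinarith
      _ = 99 / 10 * ∫ x, α x ∂ρ - 10 * ∫ x, α x * accReal T V π.1 x ∂ρ := by
          rw [integral_sub (hαi.const_mul _) (hαacc.const_mul _), integral_const_mul,
            integral_const_mul]
      _ ≤ τ := by
          have : 0 ≤ ∫ x, α x ∂ρ := integral_nonneg fun x => hα0 x
          linarith

/-- If no phase fails, the final potential exceeds the initial one by at most `k τ`. -/
theorem integral_meanRank_betaW_le (hV : ∀ y, MeasurableSet {x | V x y = true}) (ρ : Measure X)
    [IsProbabilityMeasure ρ] (hm : 0 < m) (ens : Fin k → M) {τ : ℝ} (hτ : 0 < τ)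
    (h : ∀ (j : ℕ) (hj : j + 1 ≤ k), ¬ FailsPhase T m ρ V (Nat.le_of_succ_le hj)
      (fun r => ens (Fin.castLE (Nat.le_of_succ_le hj) r)) τ (ens ⟨j, hj⟩).1)
    {j : ℕ} (hj : j ≤ k) :
    ∫ x, meanRank T m V hj (fun r => ens (Fin.castLE hj r)) (betaW k (k - j)) x ∂ρ ≤
      betaW k k 0 + j * τ := by
  induction j with
  | zero =>
    simp [meanRank, rankOf]
  | succ j ih =>
    have hint : ∀ {i : ℕ} (hi : i ≤ k) (s : ℕ), Integrable
        (meanRank T m V hi (fun r => ens (Fin.castLE hi r)) (betaW k s)) ρ :=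
      fun hi s => integrable_meanRank ρ hV hi _ (betaW_nonneg k s) (betaW_le_one k s)
    have h1 := ih (Nat.le_of_succ_le hj)
    have h2 := integral_drift_le hV ρ hm hj _ (ens ⟨j, hj⟩) hτ (h j hj)
    simp only [← meanRank_betaW_succ_sub] at h2
    rw [integral_sub (hint _ _) (hint _ _)] at h2
    push_cast
    linarith

/-- If no phase fails, then the mixture is accurate on all but an `ε`-fraction of the prompts. -/
theorem le_measure_accAt_mixture [NeZero k] (hV : ∀ y, MeasurableSet {x | V x y = true})
    (ρ : Measure X) [IsProbabilityMeasure ρ] (hm : 1000 ≤ m) (ens : Fin k → M) {ε : ℝ} (hε : 0 < ε)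
    (hk : betaW k k 0 ≤ 96 / 100 * ε)
    (h : ∀ (j : ℕ) (hj : j + 1 ≤ k), ¬ FailsPhase T m ρ V (Nat.le_of_succ_le hj)
      (fun r => ens (Fin.castLE (Nat.le_of_succ_le hj) r)) (ε / (100 * k)) (ens ⟨j, hj⟩).1) :
    ENNReal.ofReal (1 - ε) ≤ ρ {x | 3 / 5 ≤ accAt V (mixture (T := T) ens) x} := by
  have hk0 : (0 : ℝ) < k := by exact_mod_cast NeZero.pos k
  set S := {x | 3 / 5 ≤ accAt V (mixture (T := T) ens) x}
  have hpot := integral_meanRank_betaW_le hV ρ (by omega) ens (by positivity) h le_rfl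
  have hkτ : k * (ε / (100 * k)) = ε / 100 := by field_simp
  rw [Nat.sub_self, hkτ] at hpot
  have hint : Integrable (meanRank T m V le_rfl ens (betaW k 0)) ρ :=
    integrable_meanRank ρ hV le_rfl ens (betaW_nonneg k 0) (betaW_le_one k 0)
  have hmarkov := mul_meas_ge_le_integral_of_nonneg (μ := ρ) (Filter.Eventually.of_forall
    (meanRank_nonneg T m V le_rfl ens (betaW_nonneg k 0))) hint (98 / 100)
  have hsub : Sᶜ ⊆ {x | 98 / 100 ≤ meanRank T m V le_rfl ens (betaW k 0) x} := by
    intro x hx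
    refine le_meanRank_betaW T m V hm ens x ?_
    have hx' : accAt V (mixture (T := T) ens) x < 3 / 5 := not_le.1 hx
    have h35 : (3 / 5 : ℝ≥0∞) ≠ ∞ := ENNReal.div_ne_top (by simp) (by simp)
    have := (ENNReal.toReal_lt_toReal (accAt_ne_top V _ x) h35).2 hx'
    simpa using this
  have hSc : ρ.real Sᶜ ≤ ε := by
    have h1 := measureReal_mono (μ := ρ) hsub
    have h2 : ∫ x, meanRank T m V le_rfl ens (betaW k 0) x ∂ρ ≤ 97 / 100 * ε :=
      hpot.trans (by linarith)
    linarith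
  have huniv : ρ.real Set.univ ≤ ρ.real S + ρ.real Sᶜ := by
    rw [← Set.union_compl_self S]
    exact measureReal_union_le S Sᶜ
  rw [probReal_univ] at huniv
  refine ENNReal.ofReal_le_of_le_toReal ?_
  change 1 - ε ≤ ρ.real S
  linarith

end

/-! ### Numbers of queries and of samples -/

section Counting

variable {Tok : Type*} [MeasurableSpace Tok] [Fintype Tok]
  {X : Set (Str Tok)} {M : Finset (Model Tok)} {k T m : ℕ}

theorem run_cotQueries_le (V : X → Tok → Bool) (erm : ERMOracle M X T) (N : ℕ) {n : ℕ}
    (ω : Fin n → X × Tape M T k m) {j : ℕ} (hj : j ≤ k) :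
    (run V erm N ω j hj).cotQueries ≤ j * N := by
  induction j with
  | zero => simp [run]
  | succ j ih =>
    simp only [run, phase]
    calc _ ≤ j * N + N := add_le_add (ih _) (length_sample_le _ _ _)
      _ = (j + 1) * N := by ring

theorem run_ermCalls (V : X → Tok → Bool) (erm : ERMOracle M X T) (N : ℕ) {n : ℕ}
    (ω : Fin n → X × Tape M T k m) {j : ℕ} (hj : j ≤ k) :
    (run V erm N ω j hj).ermCalls = j := by
  induction j with
  | zero => rfl
  | succ j ih =>
    simp only [run, phase]
    rw [ih]

end Counting

theorem one_le_log_four_hundred : 1 ≤ Real.log 400 := by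
  rw [Real.le_log_iff_exp_le (by norm_num)]
  linarith [Real.exp_one_lt_d9]

theorem half_le_log {card : ℕ} (h : 2 ≤ card) : 1 / 2 ≤ Real.log card := by
  have h1 : Real.log 2 ≤ Real.log card :=
    Real.log_le_log two_pos (by exact_mod_cast h)
  linarith [Real.log_two_gt_d9]

section Bounds

variable {C c ε δ P : ℝ} {card k N n : ℕ}

theorem numPhases_lower (hC : 1 ≤ C) (hε : 0 < ε) (hε1 : ε < 1) :
    160000 * Real.log ε⁻¹ ≤ numPhases C ε := by
  have h0 : 0 ≤ Real.log ε⁻¹ := Real.log_nonneg ((one_le_inv₀ hε).2 hε1.le)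
  refine le_trans ?_ (Nat.le_ceil _)
  rw [one_div ε]
  calc 160000 * Real.log ε⁻¹ = 1 * Real.log ε⁻¹ / (1 / 400) ^ 2 := by ring
    _ ≤ C * Real.log ε⁻¹ / (1 / 400) ^ 2 := by gcongr

theorem numPhases_upper (hC : 1 ≤ C) (hε : 0 < ε) (hε1 : ε < 1) :
    (numPhases C ε : ℝ) ≤ (160000 * C + 1) * (1 + Real.log ε⁻¹) := by
  have h0 : 0 ≤ Real.log ε⁻¹ := Real.log_nonneg ((one_le_inv₀ hε).2 hε1.le)
  have h1 : (0 : ℝ) ≤ C * Real.log (1 / ε) / (1 / 400) ^ 2 := by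
    rw [one_div ε]; positivity
  refine (Nat.ceil_lt_add_one h1).le.trans ?_
  rw [one_div ε]
  have : C * Real.log ε⁻¹ / (1 / 400) ^ 2 = 160000 * C * Real.log ε⁻¹ := by ring
  rw [this]
  nlinarith

theorem log_div_nonneg (hcard : 2 ≤ card) (hk : 1 ≤ k) (hδ : 0 < δ) (hδ1 : δ < 1 / 2) :
    0 ≤ Real.log (card / (δ / k)) := by
  have hk' : (1 : ℝ) ≤ k := by exact_mod_cast hk
  have hcard' : (2 : ℝ) ≤ card := by exact_mod_cast hcard
  refine Real.log_nonneg ?_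
  rw [le_div_iff₀ (by positivity), one_mul, div_le_iff₀ (by positivity)]
  nlinarith

theorem log_div_le {K : ℝ} (hcard : 2 ≤ card) (hk : 1 ≤ k) (hδ : 0 < δ) (hP : 1 ≤ P)
    (hd : Real.log δ⁻¹ ≤ P) (hkP : k ≤ K * P) :
    Real.log (card / (δ / k)) ≤ (2 * K + 3) * (Real.log card * P) := by
  have hk' : (1 : ℝ) ≤ k := by exact_mod_cast hk
  have hcard' : (2 : ℝ) ≤ card := by exact_mod_cast hcard
  have hlog := half_le_log hcard
  have hlogk : Real.log k ≤ k := (Real.log_le_sub_one_of_pos (by linarith)).trans (by linarith)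
  have h1 : Real.log (card / (δ / k)) = Real.log card + Real.log δ⁻¹ + Real.log k := by
    rw [Real.log_inv, Real.log_div (by positivity) (by positivity),
      Real.log_div (by positivity) (by positivity)]
    ring
  have hK : 0 ≤ K := by
    by_contra hK
    nlinarith
  rw [h1]
  have h2 : Real.log card ≤ Real.log card * P := by nlinarith
  have h3 : (K + 1) * P ≤ (K + 1) * (2 * (Real.log card * P)) := by
    have : P ≤ 2 * (Real.log card * P) := by nlinarith
    gcongr
  linarith

theorem nPrompt_lower (hc : 1 ≤ c) (h : 0 ≤ Real.log (card / (δ / k))) :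
    160000 * Real.log (card / (δ / k)) ≤ nPrompt c card (1 / 400) (δ / k) := by
  refine le_trans ?_ (Nat.le_ceil _)
  have h400 := one_le_log_four_hundred
  rw [one_div_one_div]
  calc 160000 * Real.log (card / (δ / k))
      = 1 * (Real.log (card / (δ / k)) * 1 / (1 / 400) ^ 2) := by ring
    _ ≤ c * (Real.log (card / (δ / k)) * Real.log 400 / (1 / 400) ^ 2) := by gcongr

theorem nPrompt_upper {K : ℝ} (hc : 1 ≤ c) (hcard : 2 ≤ card) (hP : 1 ≤ P)
    (h : 0 ≤ Real.log (card / (δ / k)))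
    (h' : Real.log (card / (δ / k)) ≤ K * (Real.log card * P)) :
    (nPrompt c card (1 / 400) (δ / k) : ℝ) ≤
      (64000000 * c * K + 2) * (Real.log card * P) := by
  have hlog := half_le_log hcard
  have h400 : Real.log 400 ≤ 400 :=
    (Real.log_le_sub_one_of_pos (by norm_num)).trans (by norm_num)
  have h400' := one_le_log_four_hundred
  rw [nPrompt, one_div_one_div]
  refine (Nat.ceil_lt_add_one (by positivity)).le.trans ?_
  have h1 : c * (Real.log (card / (δ / k)) * Real.log 400 / (1 / 400) ^ 2) ≤
      c * (K * (Real.log card * P) * 400 / (1 / 400) ^ 2) := by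
    have := h.trans h'
    gcongr
  have h2 : 1 ≤ 2 * (Real.log card * P) := by nlinarith
  calc _ ≤ c * (K * (Real.log card * P) * 400 / (1 / 400) ^ 2) + 2 * (Real.log card * P) :=
        add_le_add h1 h2
    _ = _ := by ring

/-- The choice of the sample sizes makes the union bound over models and phases work. -/
theorem union_bound_le {K : ℝ} (hcard : 2 ≤ card) (hk : 1 ≤ k) (hε : 0 < ε) (hε1 : ε < 1)
    (hδ : 0 < δ) (hδ1 : δ < 1 / 2) (hP : 1 ≤ P) (hkP : k ≤ K * P)
    (hH : Real.log (card / (δ / k)) ≤ (2 * K + 3) * (Real.log card * P))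
    (hN : 160000 * Real.log (card / (δ / k)) ≤ N)
    (hn : Real.log card / ε * (K * (160000 * K * (2 * K + 3) + 2) * P ^ 3) ≤ n) :
    (k : ℝ≥0∞) * (card * (ENNReal.ofReal (799 / 800) ^ N +
      ENNReal.ofReal (1 - ε / (100 * k) / 800) ^ (n / k))) ≤ ENNReal.ofReal δ := by
  set H := Real.log (card / (δ / k)) with hHdef
  have hk' : (1 : ℝ) ≤ k := by exact_mod_cast hk
  have hcard' : (2 : ℝ) ≤ card := by exact_mod_cast hcard
  have hlog := half_le_log hcard
  have hH0 : 0 ≤ H := log_div_nonneg hcard hk hδ hδ1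
  have hK : 0 ≤ K := by
    by_contra hK
    nlinarith
  have hτ1 : ε / (100 * k) ≤ 1 := by
    rw [div_le_one (by positivity)]
    linarith
  set τ := ε / (100 * k) with hτ
  have hτ0 : 0 < τ := by positivity
  -- Doubling the exponent gains more than the factor `2` needed to treat the two terms separately.
  have hexp : Real.exp (-(2 * H)) ≤ δ / (2 * (k * card)) := by
    have h1 : Real.exp (-H) = δ / (k * card) := by
      rw [Real.exp_neg, hHdef, Real.exp_log (by positivity)]
      field_simp
    have h2 : Real.exp (-(2 * H)) = Real.exp (-H) * Real.exp (-H) := by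
      rw [← Real.exp_add]; ring_nf
    have h3 : δ / (k * card) ≤ 1 / 2 := by
      rw [div_le_iff₀ (by positivity)]
      nlinarith
    rw [h2, h1]
    calc δ / (k * card) * (δ / (k * card)) ≤ δ / (k * card) * (1 / 2) := by gcongr
      _ = δ / (2 * (k * card)) := by field_simp
  have hterm1 : (799 / 800 : ℝ) ^ N ≤ δ / (2 * (k * card)) := by
    refine le_trans ?_ hexp
    calc (799 / 800 : ℝ) ^ N ≤ Real.exp (-(1 / 800)) ^ N := by
          gcongr
          have := Real.add_one_le_exp (-(1 / 800) : ℝ)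
          linarith
      _ = Real.exp (-(N / 800)) := by rw [← Real.exp_nat_mul]; ring_nf
      _ ≤ Real.exp (-(2 * H)) := Real.exp_le_exp.2 (by linarith)
  have hL : 1600 * H / τ ≤ ((n / k : ℕ) : ℝ) := by
    have h1 : (k : ℝ) * (1600 * H / τ + 1) ≤ n := by
      refine le_trans ?_ hn
      have h2 : 1600 * H / τ = 160000 * k * H / ε := by
        rw [hτ]; field_simp; ring
      rw [h2]
      have h3 : (1 : ℝ) ≤ 2 * (Real.log card * P ^ 2) / ε := by
        rw [le_div_iff₀ hε]
        have : (1 : ℝ) ≤ P ^ 2 := one_le_pow₀ hP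
        nlinarith
      calc (k : ℝ) * (160000 * k * H / ε + 1)
          ≤ (K * P) * (160000 * (K * P) * ((2 * K + 3) * (Real.log card * P)) / ε +
              2 * (Real.log card * P ^ 2) / ε) := by gcongr
        _ = _ := by ring
    have h2 : (n : ℝ) < k * ((n / k : ℕ) + 1) := by
      have : n < k * (n / k + 1) := Nat.lt_mul_div_succ n hk
      exact_mod_cast this
    have h3 := h1.trans_lt h2
    have h4 := lt_of_mul_lt_mul_left h3 (by positivity)
    linarith
  have hterm2 : (1 - τ / 800) ^ (n / k) ≤ δ / (2 * (k * card)) := by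
    refine le_trans ?_ hexp
    calc (1 - τ / 800) ^ (n / k) ≤ Real.exp (-(τ / 800)) ^ (n / k) := by
          have := Real.add_one_le_exp (-(τ / 800) : ℝ)
          refine pow_le_pow_left₀ ?_ ?_ _ <;> linarith
      _ = Real.exp (-(τ * (n / k : ℕ) / 800)) := by rw [← Real.exp_nat_mul]; ring_nf
      _ ≤ Real.exp (-(2 * H)) := by
          refine Real.exp_le_exp.2 ?_
          rw [div_le_iff₀ hτ0] at hL
          linarith
  have hreal : (k : ℝ) * (card * ((799 / 800 : ℝ) ^ N + (1 - τ / 800) ^ (n / k))) ≤ δ := by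
    calc (k : ℝ) * (card * ((799 / 800 : ℝ) ^ N + (1 - τ / 800) ^ (n / k)))
        ≤ (k : ℝ) * (card * (δ / (2 * (k * card)) + δ / (2 * (k * card)))) := by gcongr
      _ = δ := by field_simp; ring
  have hpos : 0 ≤ 1 - τ / 800 := by linarith
  rw [← ENNReal.ofReal_pow (by norm_num), ← ENNReal.ofReal_pow hpos,
    ← ENNReal.ofReal_add (by positivity) (by positivity), ← ENNReal.ofReal_natCast card,
    ← ENNReal.ofReal_natCast k, ← ENNReal.ofReal_mul (by positivity),
    ← ENNReal.ofReal_mul (by positivity)]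
  exact ENNReal.ofReal_le_ofReal hreal

end Bounds

end Autocurriculum

theorem mainTheorem2 :
    -- the algorithm's three absolute constants only have to be large enough
    ∃ (C₀ c₀ : ℝ) (m₀ : ℕ), 0 < C₀ ∧ 0 < c₀ ∧
    ∀ (C c : ℝ) (m : ℕ), C₀ ≤ C → c₀ ≤ c → m₀ ≤ m →
    -- absolute constants in the two polylogarithms and in the number of ERM calls
    ∃ (A B K : ℝ) (a b : ℕ), 0 < A ∧ 0 < B ∧ 0 < K ∧
    ∀ (Tok : Type*) [Fintype Tok] [MeasurableSpace Tok] [DiscreteMeasurableSpace Tok]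
      (X : Set (Str Tok)) (ρ : Measure X) [IsProbabilityMeasure ρ]
      (V : X → Tok → Bool) (_ : ∀ y, MeasurableSet {x | V x y = true})
      (T : ℕ) [NeZero T]
      (M : Finset (Model Tok)) (_ : 2 ≤ M.card)
      (πstar : Model Tok) (_ : πstar ∈ M)
      (_ : acc ρ V (fun x => outcome πstar T x.1) = 1)
      (erm : ERMOracle M X T)
      (ε δ : ℝ) (_ : 0 < ε) (_ : ε < 1) (_ : 0 < δ) (_ : δ < 1 / 2)
      (k : ℕ) [NeZero k] (_ : k = numPhases C ε)
      (n : ℕ) (_ : Real.log M.card / ε * polylog A a ε⁻¹ δ⁻¹ T ≤ n),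
      (∀ ω : Fin n → X × Tape M T k m,
        ((autoTune V erm c δ ω).cotQueries : ℝ) ≤ Real.log M.card * polylog B b ε⁻¹ δ⁻¹ T) ∧
      (∀ ω : Fin n → X × Tape M T k m,
        ((autoTune V erm c δ ω).ermCalls : ℝ) ≤ K * (1 + Real.log ε⁻¹)) ∧
      ENNReal.ofReal (1 - δ) ≤ inputLaw ρ πstar M T k m n
        {ω | ENNReal.ofReal (1 - ε) ≤
          ρ {x | 3 / 5 ≤ accAt V (mixture (T := T) (autoTune V erm c δ ω).ens) x}} := by
  refine ⟨1, 1, 1000, one_pos, one_pos, fun C c m hC hc hm => ?_⟩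
  set K : ℝ := 160000 * C + 1 with hK
  have hK0 : 0 < K := by positivity
  have hc0 : 0 < c := by linarith
  refine ⟨K * (160000 * K * (2 * K + 3) + 2), K * (64000000 * c * (2 * K + 3) + 2), K, 3, 2,
    by positivity, by positivity, hK0, ?_⟩
  intro Tok _ _ _ X ρ _ V hV T _ M hcard πstar hM hstar erm ε δ hε hε1 hδ hδ1 k _ hk n hn
  have hk1 : 1 ≤ k := NeZero.pos k
  have hℓ : 0 ≤ Real.log ε⁻¹ := Real.log_nonneg ((one_le_inv₀ hε).2 hε1.le)
  have hd : 0 ≤ Real.log δ⁻¹ := Real.log_nonneg ((one_le_inv₀ hδ).2 (by linarith))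
  have hT : 0 ≤ Real.log (T : ℝ) := Real.log_natCast_nonneg T
  set P : ℝ := 1 + Real.log ε⁻¹ + Real.log δ⁻¹ + Real.log T with hPdef
  have hP : 1 ≤ P := by linarith
  have hkℓ : (k : ℝ) ≤ K * (1 + Real.log ε⁻¹) := by
    rw [hk]; exact numPhases_upper hC hε hε1
  have hkP : (k : ℝ) ≤ K * P := hkℓ.trans (by gcongr; linarith)
  have hH0 := log_div_nonneg hcard hk1 hδ hδ1
  have hH := log_div_le hcard hk1 hδ hP (by linarith) hkP
  have hN := nPrompt_lower hc hH0
  have hN' := nPrompt_upper hc hcard hP hH0 hH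
  set N := nPrompt c M.card (1 / 400) (δ / k)
  refine ⟨fun ω => ?_, fun ω => ?_, ?_⟩
  · have h1 : ((autoTune V erm c δ ω).cotQueries : ℝ) ≤ (k * N : ℕ) := by
      exact_mod_cast run_cotQueries_le V erm N ω le_rfl
    refine h1.trans ?_
    push_cast
    calc (k : ℝ) * N ≤ (K * P) * ((64000000 * c * (2 * K + 3) + 2) * (Real.log M.card * P)) := by
          gcongr
      _ = Real.log M.card * polylog (K * (64000000 * c * (2 * K + 3) + 2)) 2 ε⁻¹ δ⁻¹ T := by
          rw [polylog, ← hPdef]; ring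
  · have h1 : (autoTune V erm c δ ω).ermCalls = k := run_ermCalls V erm N ω le_rfl
    rw [h1]
    exact hkℓ
  · have hk0 : (0 : ℝ) < k := by exact_mod_cast hk1
    have hτ : 0 < ε / (100 * k) := by positivity
    have hfail := (inputLaw_exists_failsPhase_le (k := k) (m := m) hV ρ hM hstar erm N n hτ).trans
      (union_bound_le hcard hk1 hε hε1 hδ hδ1 hP hkP hH hN (by rwa [polylog, ← hPdef] at hn))
    have hβ : betaW k k 0 ≤ 96 / 100 * ε :=
      betaW_zero_le hk1 hε (by rw [hk]; exact numPhases_lower hC hε hε1)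
    set good := {ω : Fin n → X × Tape M T k m | ENNReal.ofReal (1 - ε) ≤
      ρ {x | 3 / 5 ≤ accAt V (mixture (T := T) (autoTune V erm c δ ω).ens) x}}
    set bad := {ω : Fin n → X × Tape M T k m | ∃ (j : ℕ) (hj : j + 1 ≤ k),
      FailsPhase T m ρ V (Nat.le_of_succ_le hj)
        (fun r => (run V erm N ω k le_rfl).ens (Fin.castLE (Nat.le_of_succ_le hj) r))
        (ε / (100 * k)) ((run V erm N ω k le_rfl).ens ⟨j, hj⟩).1}
    have huniv : Set.univ ⊆ good ∪ bad := by
      intro ω _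
      by_cases hω : ω ∈ bad
      · exact Or.inr hω
      · refine Or.inl (le_measure_accAt_mixture hV ρ hm _ hε hβ fun j hj hf => hω ⟨j, hj, hf⟩)
    have h1 := (measure_mono (μ := inputLaw ρ πstar M T k m n) huniv).trans
      (measure_union_le good bad)
    rw [measure_univ] at h1
    rw [ENNReal.ofReal_sub _ hδ.le, ENNReal.ofReal_one]
    exact tsub_le_iff_right.2 (h1.trans (add_le_add le_rfl hfail))
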